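/- \textbf{Setting.} A CNF formula has a number $n$ of variables and a finite list of $m$ clauses, each a list of literals on these variables. An instance of 3-SAT is a CNF formula in which every clause has at most three literals; the question is whether some assignment makes at least one literal of every clause true. An instance of (3,4)-XSAT is a CNF formula in which every clause consists of exactly three literals on three distinct variables and every variable appears in at most four clauses; the question is whether some assignment makes exactly one literal of every clause true. Algorithms are (multi-stack, equivalently multi-tape) Turing machines, and an instance is given as the word over a finite alphabet that lists $n$ and then its clauses (with indices of variables in unary). A problem can be decided in time $2^{o(s)}$, where $s$ is a size of instances, if there are a function $f:\mathbb{N}\to\mathbb{R}$ with $f(s)=o(s)$ and a Turing machine that gives the correct answer on every instance of size $s$ within $2^{f(s)}$ steps. The Exponential Time Hypothesis (ETH) is used in the following form: 3-SAT on instances with $n$ variables and $m$ clauses cannot be decided in time $2^{o(n+m)}$. \textbf{Theorem.} Assume the ETH. Then (3,4)-XSAT cannot be decided in time $2^{o(n)}$, where $n$ denotes the number of variables of the input formula. -/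

import Mathlib

namespace SatHardness

/-- A formula in conjunctive normal form over the variables `0, …, numVars - 1`, as a list of
clauses. A clause is a list of literals, and the literal `(v, b)` is true under the assignment `a`
iff `a v = b`; so `(v, true)` is the variable `v` and `(v, false)` is its negation. -/
structure Formula where
  numVars : ℕ
  clauses : List (List (Fin numVars × Bool))

namespace Formula

def numClauses (φ : Formula) : ℕ := φ.clauses.length

/-- Some assignment makes at least one literal of every clause true. -/
def Satisfiable (φ : Formula) : Prop :=
  ∃ a : Fin φ.numVars → Bool, ∀ c ∈ φ.clauses, ∃ l ∈ c, a l.1 = l.2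

/-- Some assignment makes exactly one literal of every clause true. -/
def ExactlyOneSatisfiable (φ : Formula) : Prop :=
  ∃ a : Fin φ.numVars → Bool, ∀ c ∈ φ.clauses, c.countP (fun l => a l.1 == l.2) = 1

/-- The instances of 3-SAT: every clause has at most three literals. -/
def IsThreeCNF (φ : Formula) : Prop :=
  ∀ c ∈ φ.clauses, c.length ≤ 3

/-- The instances of (3,4)-XSAT: every clause consists of three literals on three distinct
variables, and every variable appears in at most four clauses. -/
def IsThreeFour (φ : Formula) : Prop :=
  (∀ c ∈ φ.clauses, c.length = 3 ∧ (c.map Prod.fst).Nodup) ∧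
    ∀ v : Fin φ.numVars, φ.clauses.countP (fun c => decide (v ∈ c.map Prod.fst)) ≤ 4

end Formula

/-- The finite alphabet over which formulas are written. -/
inductive Symbol
  | tick
  | pos
  | neg
  | mark
  deriving DecidableEq

/-- A literal is the index of its variable in unary, followed by its sign. -/
def encodeLiteral {n : ℕ} (l : Fin n × Bool) : List Symbol :=
  List.replicate l.1.val Symbol.tick ++ [if l.2 then Symbol.pos else Symbol.neg]

/-- A clause is the sequence of its literals, followed by `mark`. -/
def encodeClause {n : ℕ} (c : List (Fin n × Bool)) : List Symbol :=
  c.flatMap encodeLiteral ++ [Symbol.mark]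

/-- A formula is its number of variables in unary, followed by `mark` and the sequence of its
clauses. Indices are smaller than the number of variables, so this word is only polynomially longer
than one with binary indices, and running times `2 ^ o(n)` do not depend on that choice. -/
def encodeFormula (φ : Formula) : List Symbol :=
  List.replicate φ.numVars Symbol.tick ++ [Symbol.mark] ++ φ.clauses.flatMap encodeClause

open Classical in
/-- The problem "given a formula `φ` with `IsInstance φ`, is `IsYes φ` true?" can be decided in time
`2 ^ o(size)`: there are a function `f` with `f n = o(n)` and one Turing machine (with finitely many
stacks and finite control) that, started on the word for any instance `φ`, halts after at most
`2 ^ f (size φ)` steps with the correct answer as its output. Nothing is asked of the machine on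
words that are not instances. -/
def DecidableInSubexpTime (IsInstance IsYes : Formula → Prop) (size : Formula → ℕ) : Prop :=
  ∃ f : ℕ → ℝ, f =o[Filter.atTop] (fun n : ℕ => (n : ℝ)) ∧
    ∃ M : Turing.TM2ComputableAux Symbol Bool,
      ∀ φ : Formula, IsInstance φ →
        ∃ t : ℕ, (t : ℝ) ≤ (2 : ℝ) ^ f (size φ) ∧
          Nonempty (Turing.TM2OutputsInTime M.tm
            ((encodeFormula φ).map M.inputAlphabet.symm)
            (some ([decide (IsYes φ)].map M.outputAlphabet.symm)) t)

/-- The Exponential Time Hypothesis, in the form: 3-SAT on instances with `n` variables and `m`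
clauses cannot be solved in time `2 ^ o(n + m)`. -/
def ETH : Prop :=
  ¬ DecidableInSubexpTime Formula.IsThreeCNF Formula.Satisfiable
      (fun φ => φ.numVars + φ.numClauses)

end SatHardness

namespace SatHardness

open Turing StateTransition

/-! The theorem follows from a reduction of 3-SAT to (3,4)-XSAT that increases the size only
linearly and is computed by a stack machine in polynomial time.

Read a formula as a sequence of items: literal occurrences and ends of clauses. Each item gets a
block of eight fresh variables. Along a clause, the first variables of the blocks carry the
information "a true literal has already been selected" from one block to the next; an exactly-one
constraint lets it become true only at a true literal, and the end of the clause demands that it is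
true and resets it. Every literal occurrence has its own copy of its variable, so clauses that are
empty or repeat a variable need no special care. The copies of one variable are made equal by a
chain of links, two clauses `(x, y, z)` and `(x', y, z)` with fresh `y`, `z`; a copy is in at most
two links, which keeps the number of occurrences bounded. Correctness is `exists_exactlyOneSat_iff`,
and the bound four is `occurrences_reductionClauses`.

To find the occurrences of one variable with stacks only, the reduction makes `n` rounds over the
items. Each round links the literals of index zero and decreases all other indices. It is written in
a small register language, compiled to a stack machine by `Runs.stepsTo` and put in front of a given
machine by `precompose_outputsInTime`. Its time is cubic in the number `N` of new variables
(`exists_runs_reduceProg`). As `N` is linear in `n + m`, a running time `2 ^ o(N)` for (3,4)-XSAT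
becomes `2 ^ o(n + m)` for 3-SAT, against the ETH. -/

instance : Fintype Symbol :=
  ⟨{Symbol.tick, Symbol.pos, Symbol.neg, Symbol.mark}, fun x => by cases x <;> decide⟩

/-! ### A register language with exact step counts -/

/-- The registers of a `Prog`; each of them is a stack of symbols. -/
inductive Reg
  | inp | aux | base | tmp | cnt | last | out
  deriving DecidableEq

instance : Fintype Reg :=
  ⟨{.inp, .aux, .base, .tmp, .cnt, .last, .out}, fun x => by cases x <;> decide⟩

/-- The contents of the registers. -/
structure Store where
  inp : List Symbol
  aux : List Symbol
  base : List Symbol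
  tmp : List Symbol
  cnt : List Symbol
  last : List Symbol
  out : List Symbol

namespace Store

def get (s : Store) : Reg → List Symbol
  | .inp => s.inp
  | .aux => s.aux
  | .base => s.base
  | .tmp => s.tmp
  | .cnt => s.cnt
  | .last => s.last
  | .out => s.out

def set (s : Store) : Reg → List Symbol → Store
  | .inp, x => { s with inp := x }
  | .aux, x => { s with aux := x }
  | .base, x => { s with base := x }
  | .tmp, x => { s with tmp := x }
  | .cnt, x => { s with cnt := x }
  | .last, x => { s with last := x }
  | .out, x => { s with out := x }

theorem get_set (s : Store) (k : Reg) (x : List Symbol) :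
    (s.set k x).get = Function.update s.get k x := by
  funext k'
  cases k <;> cases k' <;> rfl

end Store

/-- Structured programs on the registers. -/
inductive Prog
  | push (k : Reg) (a : Symbol)
  | pop (k : Reg)
  | move (k k' : Reg)
  | seq (p q : Prog)
  | ite (k : Reg) (P : Option Symbol → Bool) (p q : Prog)
  | loop (k : Reg) (P : Option Symbol → Bool) (p : Prog)

/-- `Runs p s s' t`: started on `s`, the program `p` stops after `t` steps with `s'`. Tests look at
the top of a register. -/
inductive Runs : Prog → Store → Store → ℕ → Prop
  | push (k : Reg) (a : Symbol) (s : Store) : Runs (.push k a) s (s.set k (a :: s.get k)) 1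
  | pop (k : Reg) (s : Store) : Runs (.pop k) s (s.set k (s.get k).tail) 1
  | move (k k' : Reg) (s : Store) (a : Symbol) (l : List Symbol) (h : s.get k = a :: l) :
      Runs (.move k k') s ((s.set k l).set k' (a :: (s.set k l).get k')) 1
  | seq {p q : Prog} {s s₁ s₂ : Store} {t₁ t₂ : ℕ} (h₁ : Runs p s s₁ t₁) (h₂ : Runs q s₁ s₂ t₂) :
      Runs (.seq p q) s s₂ (t₂ + t₁)
  | ite_true {k : Reg} {P : Option Symbol → Bool} {p q : Prog} {s s₁ : Store} {t : ℕ}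
      (h : P (s.get k).head? = true) (h₁ : Runs p s s₁ t) : Runs (.ite k P p q) s s₁ (t + 1)
  | ite_false {k : Reg} {P : Option Symbol → Bool} {p q : Prog} {s s₁ : Store} {t : ℕ}
      (h : P (s.get k).head? = false) (h₁ : Runs q s s₁ t) : Runs (.ite k P p q) s s₁ (t + 1)
  | loop_true {k : Reg} {P : Option Symbol → Bool} {p : Prog} {s s₁ s₂ : Store} {t₁ t₂ : ℕ}
      (h : P (s.get k).head? = true) (h₁ : Runs p s s₁ t₁) (h₂ : Runs (.loop k P p) s₁ s₂ t₂) :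
      Runs (.loop k P p) s s₂ (t₂ + (t₁ + 1))
  | loop_false {k : Reg} {P : Option Symbol → Bool} {p : Prog} {s : Store}
      (h : P (s.get k).head? = false) : Runs (.loop k P p) s s 1

namespace Prog

/-- The control points of a program. -/
def Label : Prog → Type
  | push _ _ => Unit
  | pop _ => Unit
  | move _ _ => Unit
  | seq p q => p.Label ⊕ q.Label
  | ite _ _ p q => Option (p.Label ⊕ q.Label)
  | loop _ _ p => Option p.Label

@[reducible]
def labelFintype : (p : Prog) → Fintype p.Label
  | push _ _ => inferInstanceAs (Fintype Unit)
  | pop _ => inferInstanceAs (Fintype Unit)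
  | move _ _ => inferInstanceAs (Fintype Unit)
  | seq p q =>
    letI := labelFintype p
    letI := labelFintype q
    inferInstanceAs (Fintype (p.Label ⊕ q.Label))
  | ite _ _ p q =>
    letI := labelFintype p
    letI := labelFintype q
    inferInstanceAs (Fintype (Option (p.Label ⊕ q.Label)))
  | loop _ _ p =>
    letI := labelFintype p
    inferInstanceAs (Fintype (Option p.Label))

instance (p : Prog) : Fintype p.Label := labelFintype p

def entry : (p : Prog) → p.Label
  | push _ _ => ()
  | pop _ => ()
  | move _ _ => ()
  | seq p _ => Sum.inl p.entry
  | ite _ _ _ _ => none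
  | loop _ _ _ => none

end Prog

/-! ### Compilation to stack machines, and embedding of a machine into a larger one -/

section Machine

variable {K : Type} {Γ : K → Type} {Λ Λ' σ : Type}

/-- The stack alphabets of a machine enlarged by the registers. -/
abbrev JoinAlphabet (Γ : K → Type) : Reg ⊕ K → Type := Sum.elim (fun _ => Symbol) Γ

/-- The stacks of a machine enlarged by the registers. -/
def joinStacks (s : Store) (T : ∀ k, List (Γ k)) : ∀ k, List (JoinAlphabet Γ k)
  | .inl k => s.get k
  | .inr k => T k

theorem joinStacks_nil :
    joinStacks ⟨[], [], [], [], [], [], []⟩ (fun k => ([] : List (Γ k))) = fun _ => [] := by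
  funext k
  rcases k with k | k
  · cases k <;> rfl
  · rfl

theorem update_joinStacks_inl [DecidableEq K] (s : Store) (T : ∀ k, List (Γ k)) (k : Reg)
    (x : List Symbol) :
    Function.update (joinStacks s T) (Sum.inl k) x = joinStacks (s.set k x) T := by
  funext k'
  rcases k' with k' | k'
  · by_cases h : k' = k
    · subst h
      exact (Function.update_self (Sum.inl k') x (joinStacks s T)).trans
        (congrFun (Store.get_set s k' x) k' |>.trans (Function.update_self ..)).symm
    · have h' : (Sum.inl k' : Reg ⊕ K) ≠ Sum.inl k := by simpa using h
      exact (Function.update_of_ne h' x (joinStacks s T)).trans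
        (congrFun (Store.get_set s k x) k' |>.trans (Function.update_of_ne h ..)).symm
  · exact Function.update_of_ne (by simp) ..

theorem update_joinStacks_inr [DecidableEq K] (s : Store) (T : ∀ k, List (Γ k)) (k : K)
    (x : List (Γ k)) :
    Function.update (joinStacks s T) (Sum.inr k) x = joinStacks s (Function.update T k x) := by
  funext k'
  rcases k' with k' | k'
  · exact Function.update_of_ne (by simp) ..
  · by_cases h : k' = k
    · subst h
      exact (Function.update_self (Sum.inr k') x (joinStacks s T)).trans
        (Function.update_self k' x T).symm
    · have h' : (Sum.inr k' : Reg ⊕ K) ≠ Sum.inr k := by simpa using h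
      exact (Function.update_of_ne h' x (joinStacks s T)).trans
        (Function.update_of_ne h x T).symm

/-- The statements at the control points of a program that continues at `exit`. -/
def Prog.code : (p : Prog) → (p.Label → Λ) → Λ → p.Label →
    TM2.Stmt (JoinAlphabet Γ) Λ (Option Symbol × σ)
  | push k a, _, exit, _ => .push (.inl k) (fun _ => a) (.goto fun _ => exit)
  | pop k, _, exit, _ => .pop (.inl k) (fun v _ => v) (.goto fun _ => exit)
  | move k k', _, exit, _ =>
    .pop (.inl k) (fun v a => (a, v.2))
      -- The default is used only on an empty register, where `Runs.move` provides no run.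
      (.push (.inl k') (fun v => v.1.getD Symbol.tick) (.goto fun _ => exit))
  | seq p q, emb, _, .inl l => p.code (fun l => emb (.inl l)) (emb (.inr q.entry)) l
  | seq _ q, emb, exit, .inr l => q.code (fun l => emb (.inr l)) exit l
  | ite k P p q, emb, _, none =>
    .peek (.inl k) (fun v a => (a, v.2))
      (.goto fun v => if P v.1 then emb (some (.inl p.entry)) else emb (some (.inr q.entry)))
  | ite _ _ p _, emb, exit, some (.inl l) => p.code (fun l => emb (some (.inl l))) exit l
  | ite _ _ _ q, emb, exit, some (.inr l) => q.code (fun l => emb (some (.inr l))) exit l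
  | loop k P p, emb, exit, none =>
    .peek (.inl k) (fun v a => (a, v.2))
      (.goto fun v => if P v.1 then emb (some p.entry) else exit)
  | loop _ _ p, emb, _, some l => p.code (fun l => emb (some l)) (emb none) l

/-- `StepsTo m n c c'`: the machine `m` goes from `c` to `c'` in `n` steps. -/
def StepsTo [DecidableEq K] (m : Λ → TM2.Stmt Γ Λ σ) (n : ℕ) (c c' : TM2.Cfg Γ Λ σ) : Prop :=
  (flip bind (TM2.step m))^[n] (some c) = some c'

theorem StepsTo.trans [DecidableEq K] {m : Λ → TM2.Stmt Γ Λ σ} {n₁ n₂ : ℕ}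
    {c₁ c₂ c₃ : TM2.Cfg Γ Λ σ} (h₁ : StepsTo m n₁ c₁ c₂) (h₂ : StepsTo m n₂ c₂ c₃) :
    StepsTo m (n₂ + n₁) c₁ c₃ := by
  unfold StepsTo at *
  rw [Function.iterate_add_apply, h₁, h₂]

theorem StepsTo.single [DecidableEq K] {m : Λ → TM2.Stmt Γ Λ σ} {l : Λ} {v : σ}
    {T : ∀ k, List (Γ k)} {c : TM2.Cfg Γ Λ σ} (h : TM2.stepAux (m l) v T = c) :
    StepsTo m 1 ⟨some l, v, T⟩ c :=
  congrArg some h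

/-- Every control point is one statement that ends in its jump. Hence a push, pop, move or test
costs exactly one step and sequencing costs none. The symbol buffer `r` is always overwritten before
it is read, so its final value is left open. -/
theorem Runs.stepsTo [DecidableEq K] {p : Prog} {s s' : Store} {t : ℕ} (h : Runs p s s' t)
    (m : Λ → TM2.Stmt (JoinAlphabet Γ) Λ (Option Symbol × σ)) (emb : p.Label → Λ) (exit : Λ)
    (hm : ∀ l, m (emb l) = p.code emb exit l) (r : Option Symbol) (v : σ)
    (T : ∀ k, List (Γ k)) :
    ∃ r', StepsTo m t ⟨some (emb p.entry), (r, v), joinStacks s T⟩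
      ⟨some exit, (r', v), joinStacks s' T⟩ := by
  induction h generalizing exit r with
  | push k a s =>
    refine ⟨r, .single ?_⟩
    rw [hm]
    simp only [Prog.code, TM2.stepAux]
    rw [← update_joinStacks_inl]
    rfl
  | pop k s =>
    refine ⟨r, .single ?_⟩
    rw [hm]
    simp only [Prog.code, TM2.stepAux]
    rw [← update_joinStacks_inl]
    rfl
  | move k k' s a l h =>
    refine ⟨some a, .single ?_⟩
    rw [hm]
    simp only [Prog.code, TM2.stepAux]
    have h1 : joinStacks s T (.inl k) = a :: l := h
    rw [← update_joinStacks_inl, ← update_joinStacks_inl, h1]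
    rw [show (s.set k l).get k' = joinStacks (s.set k l) T (.inl k') from rfl,
      ← update_joinStacks_inl]
    rfl
  | @seq p q _ _ _ _ _ _ _ ih₁ ih₂ =>
    obtain ⟨r₁, h₁⟩ := ih₁ (fun l => emb (.inl l)) (emb (.inr q.entry)) (fun l => hm (.inl l)) r
    obtain ⟨r₂, h₂⟩ := ih₂ (fun l => emb (.inr l)) exit (fun l => hm (.inr l)) r₁
    exact ⟨r₂, h₁.trans h₂⟩
  | @ite_true k P p q s _ _ h _ ih =>
    obtain ⟨r₁, h₁⟩ := ih (fun l => emb (some (.inl l))) exit (fun l => hm (some (.inl l)))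
      (s.get k).head?
    refine ⟨r₁, StepsTo.trans (.single ?_) h₁⟩
    rw [hm]
    simp only [Prog.entry, Prog.code, TM2.stepAux, joinStacks]
    exact congrArg (fun l => TM2.Cfg.mk (some l) _ _) (if_pos h)
  | @ite_false k P p q s _ _ h _ ih =>
    obtain ⟨r₁, h₁⟩ := ih (fun l => emb (some (.inr l))) exit (fun l => hm (some (.inr l)))
      (s.get k).head?
    refine ⟨r₁, StepsTo.trans (.single ?_) h₁⟩
    rw [hm]
    simp only [Prog.entry, Prog.code, TM2.stepAux, joinStacks]
    exact congrArg (fun l => TM2.Cfg.mk (some l) _ _) (if_neg (Bool.eq_false_iff.1 h))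
  | @loop_true k P p s _ _ _ _ h _ _ ih₁ ih₂ =>
    obtain ⟨r₁, h₁⟩ := ih₁ (fun l => emb (some l)) (emb none) (fun l => hm (some l))
      (s.get k).head?
    obtain ⟨r₂, h₂⟩ := ih₂ emb exit hm r₁
    refine ⟨r₂, StepsTo.trans (StepsTo.trans (.single ?_) h₁) h₂⟩
    rw [hm]
    simp only [Prog.entry, Prog.code, TM2.stepAux, joinStacks]
    exact congrArg (fun l => TM2.Cfg.mk (some l) _ _) (if_pos h)
  | @loop_false k P p s h =>
    refine ⟨(s.get k).head?, .single ?_⟩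
    rw [hm]
    simp only [Prog.entry, Prog.code, TM2.stepAux, joinStacks]
    exact congrArg (fun l => TM2.Cfg.mk (some l) _ _) (if_neg (Bool.eq_false_iff.1 h))

/-- A statement of a machine, acting on its own part of the enlarged machine. -/
def liftStmt (emb : Λ → Λ') : TM2.Stmt Γ Λ σ → TM2.Stmt (JoinAlphabet Γ) Λ' (Option Symbol × σ)
  | .push k f q => .push (.inr k) (fun v => f v.2) (liftStmt emb q)
  | .peek k f q => .peek (.inr k) (fun v a => (v.1, f v.2 a)) (liftStmt emb q)
  | .pop k f q => .pop (.inr k) (fun v a => (v.1, f v.2 a)) (liftStmt emb q)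
  | .load f q => .load (fun v => (v.1, f v.2)) (liftStmt emb q)
  | .branch f q₁ q₂ => .branch (fun v => f v.2) (liftStmt emb q₁) (liftStmt emb q₂)
  | .goto f => .goto fun v => emb (f v.2)
  | .halt => .halt

/-- A configuration of a machine, as a configuration of the enlarged machine. -/
def liftCfg (emb : Λ → Λ') (r : Option Symbol) (s : Store) (c : TM2.Cfg Γ Λ σ) :
    TM2.Cfg (JoinAlphabet Γ) Λ' (Option Symbol × σ) :=
  ⟨c.l.map emb, (r, c.var), joinStacks s c.stk⟩

theorem stepAux_liftStmt [DecidableEq K] (emb : Λ → Λ') (r : Option Symbol) (s : Store)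
    (q : TM2.Stmt Γ Λ σ) (v : σ) (T : ∀ k, List (Γ k)) :
    TM2.stepAux (liftStmt emb q) (r, v) (joinStacks s T) =
      liftCfg emb r s (TM2.stepAux q v T) := by
  induction q generalizing v T with
  | push k f q ih =>
    simp only [liftStmt, TM2.stepAux]
    rw [← ih, ← update_joinStacks_inr]
    rfl
  | peek k f q ih =>
    simp only [liftStmt, TM2.stepAux]
    exact ih _ _
  | pop k f q ih =>
    simp only [liftStmt, TM2.stepAux]
    rw [← ih, ← update_joinStacks_inr]
    rfl
  | load f q ih =>
    simp only [liftStmt, TM2.stepAux]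
    exact ih _ _
  | branch f q₁ q₂ ih₁ ih₂ =>
    simp only [liftStmt, TM2.stepAux]
    cases f v
    · exact ih₂ _ _
    · exact ih₁ _ _
  | goto f => rfl
  | halt => rfl

theorem StepsTo.lift [DecidableEq K] {m : Λ → TM2.Stmt Γ Λ σ} {n : ℕ} {c c' : TM2.Cfg Γ Λ σ}
    (h : StepsTo m n c c') (m' : Λ' → TM2.Stmt (JoinAlphabet Γ) Λ' (Option Symbol × σ))
    (emb : Λ → Λ') (hm : ∀ l, m' (emb l) = liftStmt emb (m l)) (r : Option Symbol) (s : Store) :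
    StepsTo m' n (liftCfg emb r s c) (liftCfg emb r s c') := by
  -- One step commutes with the embedding, also on halted configurations, so all iterates do.
  have key : Function.Semiconj (Option.map (liftCfg emb r s)) (flip bind (TM2.step m))
      (flip bind (TM2.step m')) := by
    rintro (_ | ⟨_ | l, v, T⟩)
    · rfl
    · rfl
    · refine congrArg some ?_
      rw [← stepAux_liftStmt, ← hm]
  have := (key.iterate_right n) (some c)
  unfold StepsTo at *
  rw [h] at this
  exact this.symm

/-- Move the register `aux` to the stack `k₀`, reversing it. -/
def transferStmt (k₀ : K) (e : Γ k₀ ≃ Symbol) (self next : Λ) :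
    TM2.Stmt (JoinAlphabet Γ) Λ (Option Symbol × σ) :=
  .pop (.inl .aux) (fun v a => (a, v.2))
    (.branch (fun v => v.1.isSome)
      (.push (.inr k₀) (fun v => e.symm (v.1.getD Symbol.tick)) (.goto fun _ => self))
      (.goto fun _ => next))

/-- The extra step is the pop of the empty register. It resets the buffer to `none`, as the final
configuration will require. -/
theorem stepsTo_transferStmt [DecidableEq K] (k₀ : K) (e : Γ k₀ ≃ Symbol) (self next : Λ)
    (m : Λ → TM2.Stmt (JoinAlphabet Γ) Λ (Option Symbol × σ))
    (hm : m self = transferStmt k₀ e self next) (v : σ) (w : List Symbol) (r : Option Symbol)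
    (s : Store) (T : ∀ k, List (Γ k)) (l : List (Γ k₀)) (hs : s.get .aux = w) :
    StepsTo m (w.length + 1) ⟨some self, (r, v), joinStacks s (Function.update T k₀ l)⟩
      ⟨some next, (none, v),
        joinStacks (s.set .aux []) (Function.update T k₀ (w.reverse.map e.symm ++ l))⟩ := by
  induction w generalizing r s l with
  | nil =>
    refine .single ?_
    have h1 : joinStacks s (Function.update T k₀ l) (Sum.inl .aux) = [] := hs
    rw [hm]
    simp only [transferStmt, TM2.stepAux, h1, ← update_joinStacks_inl]
    rfl
  | cons a w ih =>
    have h1 : joinStacks s (Function.update T k₀ l) (Sum.inl .aux) = a :: w := hs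
    have := ih (some a) (s.set .aux w) (e.symm a :: l) rfl
    refine StepsTo.trans (n₁ := 1) (c₂ := ⟨some self, (some a, v),
      joinStacks (s.set .aux w) (Function.update T k₀ (e.symm a :: l))⟩) (.single ?_) ?_
    · rw [hm]
      simp only [transferStmt, TM2.stepAux, h1]
      refine congrArg (TM2.Cfg.mk (some self) (some a, v)) ?_
      have h2 : joinStacks (s.set .aux w) (Function.update T k₀ l) (.inr k₀) = l :=
        by
          change Function.update T k₀ l k₀ = l
          exact Function.update_self ..
      have h3 := update_joinStacks_inr (s.set .aux w) (Function.update T k₀ l) k₀ (e.symm a :: l)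
      rw [Function.update_idem, ← update_joinStacks_inl] at h3
      rw [← update_joinStacks_inl] at h2
      refine Eq.trans ?_ h3
      exact congrArg (fun x : List (Γ k₀) => Function.update
        (Function.update (joinStacks s (Function.update T k₀ l)) (Sum.inl Reg.aux) w)
        (Sum.inr k₀) (e.symm a :: x : List (Γ k₀))) h2
    · simpa [Store.set] using this

end Machine

/-! ### Running a program before a machine -/

theorem initList_eq (tm : FinTM2) (w : List (tm.Γ tm.k₀)) :
    initList tm w =
      ⟨some tm.main, tm.initialState, Function.update (fun _ => []) tm.k₀ w⟩ := by
  unfold initList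
  congr 1
  funext k
  by_cases h : k = tm.k₀
  · subst h
    simp
  · simp [h]

theorem haltList_eq (tm : FinTM2) (w : List (tm.Γ tm.k₁)) :
    haltList tm w =
      ⟨none, tm.initialState, Function.update (fun _ => []) tm.k₁ w⟩ := by
  unfold haltList
  congr 1
  funext k
  by_cases h : k = tm.k₁
  · subst h
    simp
  · simp [h]

/-- Run the program `p`, transfer the register `aux` to the input of `M`, and run `M`. -/
def precompose (p : Prog) (M : TM2ComputableAux Symbol Bool) : TM2ComputableAux Symbol Bool where
  tm :=
    letI := M.tm.kFin
    letI := M.tm.ΛFin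
    letI := M.tm.σFin
    { K := Reg ⊕ M.tm.K
      k₀ := .inl .inp
      k₁ := .inr M.tm.k₁
      Γ := JoinAlphabet M.tm.Γ
      Λ := p.Label ⊕ (Unit ⊕ M.tm.Λ)
      main := .inl p.entry
      σ := Option Symbol × M.tm.σ
      initialState := (none, M.tm.initialState)
      Γk₀Fin := inferInstanceAs (Fintype Symbol)
      m := fun
        | .inl l => p.code .inl (.inr (.inl ())) l
        | .inr (.inl _) =>
          transferStmt M.tm.k₀ M.inputAlphabet (.inr (.inl ())) (.inr (.inr M.tm.main))
        | .inr (.inr l) => liftStmt (fun l => .inr (.inr l)) (M.tm.m l) }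
  inputAlphabet := Equiv.refl Symbol
  outputAlphabet := M.outputAlphabet

/-- A halting configuration must have the initial internal state and all stacks empty except the
output. This is why `p` has to clear every register but `aux`. The word stands reversed in `aux`
because the transfer reverses it again. -/
theorem precompose_outputsInTime (p : Prog) (M : TM2ComputableAux Symbol Bool)
    {w w' : List Symbol} {o : List Bool} {t t' : ℕ}
    (hp : Runs p ⟨w, [], [], [], [], [], []⟩ ⟨[], w'.reverse, [], [], [], [], []⟩ t)
    (hM : Nonempty (TM2OutputsInTime M.tm (w'.map M.inputAlphabet.symm)
      (some (o.map M.outputAlphabet.symm)) t')) :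
    Nonempty (TM2OutputsInTime (precompose p M).tm (w.map (precompose p M).inputAlphabet.symm)
      (some (o.map (precompose p M).outputAlphabet.symm)) (t' + (w'.length + 1 + t))) := by
  obtain ⟨⟨⟨n, hn⟩, hle⟩⟩ := hM
  obtain ⟨r, h₁⟩ := hp.stepsTo (precompose p M).tm.m .inl (.inr (.inl ())) (fun l => rfl) none
    M.tm.initialState (fun _ => [])
  have h₂ := stepsTo_transferStmt (Λ := (precompose p M).tm.Λ) M.tm.k₀ M.inputAlphabet
    (.inr (.inl ())) (.inr (.inr M.tm.main)) (precompose p M).tm.m rfl M.tm.initialState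
    w'.reverse r ⟨[], w'.reverse, [], [], [], [], []⟩ (fun _ => []) [] rfl
  have h₃ : StepsTo M.tm.m n (initList M.tm (w'.map M.inputAlphabet.symm))
      (haltList M.tm (o.map M.outputAlphabet.symm)) := hn
  have h₄ := h₃.lift (precompose p M).tm.m (fun l => .inr (.inr l)) (fun l => rfl) none
    ⟨[], [], [], [], [], [], []⟩
  rw [Function.update_eq_self_iff.2 rfl] at h₂
  rw [initList_eq] at h₄
  have h₂' := h₁.trans h₂
  rw [List.reverse_reverse, List.append_nil, List.length_reverse] at h₂'
  have h := h₂'.trans h₄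
  refine ⟨⟨⟨n + (w'.length + 1 + t), ?_⟩, Nat.add_le_add_right hle _⟩⟩
  unfold StepsTo at h
  refine Eq.trans (congrArg _ (congrArg some ?_)) (h.trans (congrArg some ?_))
  · rw [initList_eq]
    refine congrArg _ (Eq.trans ?_ (update_joinStacks_inl ⟨[], [], [], [], [], [], []⟩
      (fun k => ([] : List (M.tm.Γ k))) .inp w))
    rw [joinStacks_nil]
    exact congrArg (Function.update _ (Sum.inl Reg.inp)) (List.map_id w)
  · rw [haltList_eq, haltList_eq]
    unfold liftCfg
    rw [← update_joinStacks_inr, joinStacks_nil]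
    rfl

/-! ### The reduction on lists of clauses, and its correctness -/

/-- `some (v, b)` is an occurrence of the literal `(v, b)`, and `none` is the end of a clause. -/
abbrev Item := Option (ℕ × Bool)

/-- Exactly one literal of every clause is true under the assignment `A`. -/
def ExactlyOneSat (A : ℕ → Bool) (cs : List (List (ℕ × Bool))) : Prop :=
  ∀ c ∈ cs, c.countP (fun l => A l.1 == l.2) = 1

/-- Constraints on the block of eight variables `u, …, u + 7` of an item. Variable `u` says that an
earlier literal of the clause is true, `u + 1` is a copy of the variable of the literal, and `u + 2`
says that the literal is the first true one of the clause. -/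
def gadget (u : ℕ) : Item → List (List (ℕ × Bool))
  | none => [[(u, false), (u + 6, true), (u + 7, true)],
      [(u, false), (u + 6, false), (u + 7, false)],
      [(u + 8, true), (u + 6, true), (u + 7, true)]]
  | some (_, b) => [[(u + 2, true), (u + 3, true), (u + 1, !b)],
      [(u + 8, false), (u, true), (u + 2, true)]]

/-- Later blocks stand in front because the program pushes its output on a stack. The variable `u +
8` in a gadget is the first variable of the next block. -/
def gadgets (u : ℕ) : List Item → List (List (ℕ × Bool))
  | [] => []
  | i :: is => gadgets (u + 8) is ++ gadget u i

/-- Constraints that force the variables `last` and `u + 1` to be equal. -/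
def link (last u : ℕ) : List (List (ℕ × Bool)) :=
  [[(last, true), (u + 4, true), (u + 5, true)], [(u + 1, true), (u + 4, true), (u + 5, true)]]

/-- Constraints that force the copies in all items `some (0, _)` to be equal to `last`. -/
def links (last u : ℕ) : List Item → List (List (ℕ × Bool))
  | [] => []
  | some (0, _) :: is => links (u + 1) (u + 8) is ++ link last u
  | some (_ + 1, _) :: is => links last (u + 8) is
  | none :: is => links last (u + 8) is

/-- Decrease the index of a literal, and remove the literals of index zero. -/
def strike : Item → Item
  | some (0, _) => none
  | some (v + 1, b) => some (v, b)
  | none => none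

/-- Constraints that force the copy in every item `some (v, _)` to be equal to the variable
`k - 1 - v`, where the blocks start at `n`. -/
def rounds (n : ℕ) : ℕ → List Item → List (List (ℕ × Bool))
  | 0, _ => []
  | k + 1, is => rounds n k (is.map strike) ++ links k n is

/-- The gadgets are the part that is emitted first, since the rounds destroy the items. -/
def reductionClauses (n : ℕ) (is : List Item) : List (List (ℕ × Bool)) :=
  rounds n n is ++ gadgets n is

theorem exactlyOneSat_append {A : ℕ → Bool} {cs ds : List (List (ℕ × Bool))} :
    ExactlyOneSat A (cs ++ ds) ↔ ExactlyOneSat A cs ∧ ExactlyOneSat A ds := by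
  simp only [ExactlyOneSat, List.mem_append]
  exact ⟨fun h => ⟨fun c hc => h c (.inl hc), fun c hc => h c (.inr hc)⟩,
    fun h c hc => hc.elim (h.1 c) (h.2 c)⟩

/-- The two clauses differ in one literal only, so these two literals have the same value. -/
theorem exactlyOneSat_link {A : ℕ → Bool} {last u : ℕ} :
    ExactlyOneSat A (link last u) ↔
      A (u + 1) = A last ∧ A (u + 4) = (!A (u + 5) && !A last) ∧
        (A (u + 5) = true → A last = false) := by
  simp only [ExactlyOneSat, link, List.forall_mem_cons, List.countP_cons, List.countP_nil]
  cases A last <;> cases A (u + 1) <;> cases A (u + 4) <;> cases A (u + 5) <;> simp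

/-- Adding the counts of the first two clauses gives `2 * (1 - A u) + 2 = 2`. Hence `u` is true,
exactly one of `u + 6` and `u + 7` is true, and the third clause makes `u + 8` false. -/
theorem exactlyOneSat_gadget_none {A : ℕ → Bool} {u : ℕ} :
    ExactlyOneSat A (gadget u none) ↔
      A u = true ∧ A (u + 8) = false ∧ A (u + 6) = !A (u + 7) := by
  simp only [ExactlyOneSat, gadget, List.forall_mem_cons, List.countP_cons, List.countP_nil]
  cases A u <;> cases A (u + 6) <;> cases A (u + 7) <;> cases A (u + 8) <;> simp

/-- The variable `u + 3` is the slack for a true literal that is not selected. Nothing forces the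
first true literal to be selected; soundness only needs that a selected literal is true. -/
theorem exactlyOneSat_gadget_some {A : ℕ → Bool} {u v : ℕ} {b : Bool} :
    ExactlyOneSat A (gadget u (some (v, b))) ↔
      A (u + 8) = (A u || A (u + 2)) ∧ (A u && A (u + 2)) = false ∧
        (A (u + 1) == b) = (A (u + 2) || A (u + 3)) ∧ (A (u + 2) && A (u + 3)) = false := by
  simp only [ExactlyOneSat, gadget, List.forall_mem_cons, List.countP_cons, List.countP_nil]
  cases b <;> cases A u <;> cases A (u + 1) <;> cases A (u + 2) <;> cases A (u + 3) <;>
    cases A (u + 8) <;> simp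

theorem eq_of_exactlyOneSat_links {A : ℕ → Bool} {is : List Item} {last u : ℕ}
    (h : ExactlyOneSat A (links last u is)) {p : ℕ} {b : Bool}
    (hp : is[p]? = some (some (0, b))) : A (u + 8 * p + 1) = A last := by
  induction is generalizing last u p with
  | nil => simp at hp
  | cons i is ih =>
    rcases i with _ | ⟨_ | v, b'⟩
    · rcases p with _ | p
      · simp at hp
      · rw [← ih h (by simpa using hp)]
        congr 1
        omega
    · rw [links, exactlyOneSat_append, exactlyOneSat_link] at h
      rcases p with _ | p
      · exact h.2.1
      · rw [← h.2.1, ← ih h.1 (by simpa using hp)]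
        congr 1
        omega
    · rcases p with _ | p
      · simp at hp
      · rw [← ih h (by simpa using hp)]
        congr 1
        omega

/-- The index `v` reaches zero after `v` rounds, when the variable being linked has dropped from `k
- 1` to `k - 1 - v`. Positions do not shift because `strike` replaces a literal by `none` instead of
deleting it. -/
theorem eq_of_exactlyOneSat_rounds {A : ℕ → Bool} {n k : ℕ} {is : List Item}
    (h : ExactlyOneSat A (rounds n k is)) {p v : ℕ} {b : Bool}
    (hp : is[p]? = some (some (v, b))) (hv : v < k) : A (n + 8 * p + 1) = A (k - 1 - v) := by
  induction k generalizing is v with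
  | zero => omega
  | succ k ih =>
    rw [rounds, exactlyOneSat_append] at h
    rcases v with _ | v
    · exact eq_of_exactlyOneSat_links h.2 hp
    · rw [ih h.1 (v := v) (by simp [hp, strike]) (by omega)]
      congr 1
      omega

theorem exactlyOneSat_links {A : ℕ → Bool} {is : List Item} {last u : ℕ}
    (h : ∀ p b, is[p]? = some (some (0, b)) → A (u + 8 * p + 1) = A last ∧
      A (u + 8 * p + 4) = (!A last) ∧ A (u + 8 * p + 5) = false) :
    ExactlyOneSat A (links last u is) := by
  induction is generalizing last u with
  | nil => simp [links, ExactlyOneSat]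
  | cons i is ih =>
    have h' : ∀ p b, is[p]? = some (some (0, b)) → A (u + 8 + 8 * p + 1) = A last ∧
        A (u + 8 + 8 * p + 4) = (!A last) ∧ A (u + 8 + 8 * p + 5) = false := by
      intro p b hp
      have := h (p + 1) b (by simpa using hp)
      rwa [show u + 8 * (p + 1) = u + 8 + 8 * p by ring] at this
    rcases i with _ | ⟨_ | v, b'⟩
    · exact ih h'
    · obtain ⟨h1, h4, h5⟩ := h 0 b' rfl
      rw [links, exactlyOneSat_append, exactlyOneSat_link]
      simp only [mul_zero, add_zero] at h1 h4 h5
      refine ⟨ih (fun p b hp => ?_), h1, by simp [h4, h5], by simp [h5]⟩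
      rw [h1]
      exact h' p b hp
    · exact ih h'

theorem exactlyOneSat_rounds {A : ℕ → Bool} {n k : ℕ} {is : List Item}
    (h : ∀ p v b, is[p]? = some (some (v, b)) → v < k → A (n + 8 * p + 1) = A (k - 1 - v) ∧
      A (n + 8 * p + 4) = (!A (k - 1 - v)) ∧ A (n + 8 * p + 5) = false) :
    ExactlyOneSat A (rounds n k is) := by
  induction k generalizing is with
  | zero => simp [rounds, ExactlyOneSat]
  | succ k ih =>
    rw [rounds, exactlyOneSat_append]
    refine ⟨ih fun p v b hp hv => ?_, exactlyOneSat_links fun p b hp => h p 0 b hp (by omega)⟩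
    have hp' : is[p]? = some (some (v + 1, b)) := by
      rw [List.getElem?_map] at hp
      match hi : is[p]? with
      | none => simp [hi] at hp
      | some none => simp [hi, strike] at hp
      | some (some (0, _)) => simp [hi, strike] at hp
      | some (some (w + 1, b')) =>
        simp only [hi, strike, Option.map_some, Option.some.injEq, Prod.mk.injEq] at hp
        rw [hp.1, hp.2]
    have := h p (v + 1) b hp' (by omega)
    rwa [show k + 1 - 1 - (v + 1) = k - 1 - v by omega] at this

/-- The items of a clause. -/
def clauseItems (c : List (ℕ × Bool)) : List Item := c.map some ++ [none]

/-- The end of the clause demands that its first block variable is true. Traced backwards, this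
truth comes from a selected literal or from the start of the clause. -/
theorem exists_true_of_exactlyOneSat_gadgets {A α : ℕ → Bool} {c : List (ℕ × Bool)}
    {is : List Item} {u : ℕ} (h : ExactlyOneSat A (gadgets u (clauseItems c ++ is)))
    (hα : ∀ p v b, (clauseItems c ++ is)[p]? = some (some (v, b)) → A (u + 8 * p + 1) = α v) :
    (A u = true ∨ ∃ l ∈ c, α l.1 = l.2) ∧
      A (u + 8 * (clauseItems c).length) = false ∧
        ExactlyOneSat A (gadgets (u + 8 * (clauseItems c).length) is) := by
  induction c generalizing u with
  | nil =>
    rw [clauseItems, List.map_nil, List.nil_append, List.singleton_append, gadgets,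
      exactlyOneSat_append, exactlyOneSat_gadget_none] at h
    exact ⟨.inl h.2.1, h.2.2.1, h.1⟩
  | cons l c ih =>
    change ExactlyOneSat A (gadgets (u + 8) (clauseItems c ++ is) ++ gadget u (some (l.1, l.2)))
      at h
    rw [exactlyOneSat_append, exactlyOneSat_gadget_some] at h
    obtain ⟨hr, h8, -, h1, -⟩ := h
    have hl : A (u + 1) = α l.1 := hα 0 l.1 l.2 rfl
    have := ih hr fun p v b hp => by
      rw [← hα (p + 1) v b hp]
      congr 1
      omega
    rw [show u + 8 * (clauseItems (l :: c)).length = u + 8 + 8 * (clauseItems c).length by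
      simp [clauseItems]; ring]
    refine ⟨?_, this.2⟩
    rcases this.1 with h' | ⟨l', hl', h'⟩
    · rw [h8, Bool.or_eq_true] at h'
      refine h'.imp_right fun h2 => ⟨l, by simp, ?_⟩
      rw [h2, Bool.true_or, beq_iff_eq] at h1
      rw [← h1, hl]
    · exact .inr ⟨l', by simp [hl'], h'⟩

theorem forall_exists_true_of_exactlyOneSat_gadgets {A α : ℕ → Bool}
    {cs : List (List (ℕ × Bool))} {u : ℕ}
    (h : ExactlyOneSat A (gadgets u (cs.flatMap clauseItems)))
    (hα : ∀ p v b, (cs.flatMap clauseItems)[p]? = some (some (v, b)) → A (u + 8 * p + 1) = α v)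
    (hu : A u = false) : ∀ c ∈ cs, ∃ l ∈ c, α l.1 = l.2 := by
  induction cs generalizing u with
  | nil => simp
  | cons c cs ih =>
    rw [List.flatMap_cons] at h hα
    obtain ⟨h1, h2, h3⟩ := exists_true_of_exactlyOneSat_gadgets h hα
    rw [List.forall_mem_cons]
    refine ⟨h1.resolve_left (by simp [hu]), ih h3 (fun p v b hp => ?_) h2⟩
    rw [← hα ((clauseItems c).length + p) v b (by rw [List.getElem?_append_right] <;> simp [hp])]
    congr 1
    ring

/-- The intended value of the variable `u + j` in the block of an item, where `t` is the value of
`u` and `α` is the assignment to the variables of the items. -/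
def blockValue (α : ℕ → Bool) (t : Bool) : Item → ℕ → Bool
  | _, 0 => t
  | some (v, _), 1 => α v
  | some (v, b), 2 => α v == b && !t
  | some (v, b), 3 => α v == b && t
  | some (v, _), 4 => !α v
  | none, 6 => true
  | _, _ => false

/-- The value of the first variable in the next block. -/
def nextValue (α : ℕ → Bool) (t : Bool) : Item → Bool
  | none => false
  | some (v, b) => t || α v == b

/-- The assignment `A` has the intended values on all blocks. -/
def Models (A α : ℕ → Bool) : ℕ → Bool → List Item → Prop
  | u, t, [] => A u = t
  | u, t, i :: is => (∀ j < 8, A (u + j) = blockValue α t i j) ∧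
      Models A α (u + 8) (nextValue α t i) is

/-- Every clause contains a true literal. -/
def ClausesTrue (α : ℕ → Bool) : Bool → List Item → Prop
  | _, [] => True
  | t, none :: is => t = true ∧ ClausesTrue α false is
  | t, some (v, b) :: is => ClausesTrue α (t || α v == b) is

/-- Values are assigned block by block; agreement with `A₀` below `u` protects the earlier blocks
and the original variables. -/
theorem exists_models (α A₀ : ℕ → Bool) (u : ℕ) (t : Bool) (is : List Item) :
    ∃ A, Models A α u t is ∧ ∀ v < u, A v = A₀ v := by
  induction is generalizing A₀ u t with
  | nil =>
    exact ⟨Function.update A₀ u t, by simp [Models],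
      fun v hv => Function.update_of_ne (by omega) _ _⟩
  | cons i is ih =>
    obtain ⟨A, h1, h2⟩ := ih (fun v => if v < u then A₀ v else blockValue α t i (v - u)) (u + 8)
      (nextValue α t i)
    refine ⟨A, ⟨fun j hj => ?_, h1⟩, fun v hv => ?_⟩
    · rw [h2 _ (by omega), if_neg (by omega), Nat.add_sub_cancel_left]
    · rw [h2 _ (by omega), if_pos hv]

theorem Models.apply_start {A α : ℕ → Bool} {u : ℕ} {t : Bool} {is : List Item}
    (h : Models A α u t is) : A u = t := by
  cases is with
  | nil => exact h
  | cons i is =>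
    rw [show A u = blockValue α t i 0 from h.1 0 (by omega)]
    rcases i with _ | ⟨v, b⟩ <;> rfl

theorem Models.exactlyOneSat_gadgets {A α : ℕ → Bool} {u : ℕ} {t : Bool} {is : List Item}
    (h : Models A α u t is) (ht : ClausesTrue α t is) : ExactlyOneSat A (gadgets u is) := by
  induction is generalizing u t with
  | nil => simp [gadgets, ExactlyOneSat]
  | cons i is ih =>
    rw [gadgets, exactlyOneSat_append]
    have h8 := h.2.apply_start
    have h0 := h.apply_start
    rcases i with _ | ⟨v, b⟩
    · refine ⟨ih h.2 ht.2, exactlyOneSat_gadget_none.2 ⟨h0.trans ht.1, h8, ?_⟩⟩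
      rw [h.1 6 (by omega), h.1 7 (by omega)]
      rfl
    · refine ⟨ih h.2 ht, exactlyOneSat_gadget_some.2 ?_⟩
      rw [h8, h0, h.1 1 (by omega), h.1 2 (by omega), h.1 3 (by omega)]
      simp only [nextValue, blockValue]
      cases t <;> cases α v <;> cases b <;> decide

theorem Models.apply_block {A α : ℕ → Bool} {u : ℕ} {t : Bool} {is : List Item}
    (h : Models A α u t is) {p v : ℕ} {b : Bool} (hp : is[p]? = some (some (v, b))) :
    A (u + 8 * p + 1) = α v ∧ A (u + 8 * p + 4) = (!α v) ∧ A (u + 8 * p + 5) = false := by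
  induction is generalizing u t p with
  | nil => simp at hp
  | cons i is ih =>
    rcases p with _ | p
    · obtain rfl : i = some (v, b) := by simpa using hp
      exact ⟨h.1 1 (by omega), h.1 4 (by omega), h.1 5 (by omega)⟩
    · have := ih h.2 (by simpa using hp)
      rwa [show u + 8 + 8 * p = u + 8 * (p + 1) by ring] at this

theorem clausesTrue_clauseItems_append {α : ℕ → Bool} {t : Bool} {c : List (ℕ × Bool)}
    {is : List Item} (h : t = true ∨ ∃ l ∈ c, α l.1 = l.2) (hi : ClausesTrue α false is) :
    ClausesTrue α t (clauseItems c ++ is) := by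
  induction c generalizing t with
  | nil => exact ⟨by simpa using h, hi⟩
  | cons l c ih =>
    refine ih ?_
    simp only [List.mem_cons, exists_eq_or_imp] at h
    rw [Bool.or_eq_true, beq_iff_eq]
    tauto

theorem clausesTrue_flatMap_clauseItems {α : ℕ → Bool} {cs : List (List (ℕ × Bool))}
    (h : ∀ c ∈ cs, ∃ l ∈ c, α l.1 = l.2) : ClausesTrue α false (cs.flatMap clauseItems) := by
  induction cs with
  | nil => trivial
  | cons c cs ih =>
    rw [List.forall_mem_cons] at h
    exact clausesTrue_clauseItems_append (.inr h.1) (ih h.2)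

/-- The items of a list of clauses. The end of a clause at the beginning initializes the first
variable of the next block. -/
def formulaItems (cs : List (List (ℕ × Bool))) : List Item := none :: cs.flatMap clauseItems

theorem lt_of_formulaItems {n : ℕ} {cs : List (List (ℕ × Bool))}
    (hn : ∀ c ∈ cs, ∀ l ∈ c, l.1 < n) {p v : ℕ} {b : Bool}
    (hp : (formulaItems cs)[p]? = some (some (v, b))) : v < n := by
  have := List.mem_of_getElem? hp
  simp only [formulaItems, clauseItems, List.mem_cons, reduceCtorEq, List.mem_flatMap,
    List.mem_append, List.mem_map, Option.some.injEq, exists_eq_right, List.not_mem_nil, or_false,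
    false_or] at this
  obtain ⟨c, hc, hv⟩ := this
  exact hn c hc _ hv

theorem exists_exactlyOneSat_iff {n : ℕ} {cs : List (List (ℕ × Bool))}
    (hn : ∀ c ∈ cs, ∀ l ∈ c, l.1 < n) :
    (∃ A, ExactlyOneSat A (reductionClauses n (formulaItems cs))) ↔
      ∃ α : ℕ → Bool, ∀ c ∈ cs, ∃ l ∈ c, α l.1 = l.2 := by
  constructor
  · rintro ⟨A, hA⟩
    rw [reductionClauses, exactlyOneSat_append] at hA
    have hA' := hA.2
    rw [formulaItems, gadgets, exactlyOneSat_append, exactlyOneSat_gadget_none] at hA'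
    -- The rounds count downwards, so the variables of the formula appear in reverse order.
    refine ⟨fun v => A (n - 1 - v),
      forall_exists_true_of_exactlyOneSat_gadgets (α := fun v => A (n - 1 - v)) hA'.1
      (fun p v b hp => ?_) hA'.2.2.1⟩
    have hp' : (formulaItems cs)[p + 1]? = some (some (v, b)) := hp
    rw [← eq_of_exactlyOneSat_rounds hA.1 hp' (lt_of_formulaItems hn hp')]
    congr 1
    ring
  · rintro ⟨α, hα⟩
    -- The start value is `true` because the leading end of a clause demands it.
    obtain ⟨A, h1, h2⟩ := exists_models α (fun v => α (n - 1 - v)) n true (formulaItems cs)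
    refine ⟨A, exactlyOneSat_append.2 ⟨exactlyOneSat_rounds fun p v b hp hv => ?_,
      h1.exactlyOneSat_gadgets ⟨rfl, clausesTrue_flatMap_clauseItems hα⟩⟩⟩
    rw [h2 (n - 1 - v) (by omega), show n - 1 - (n - 1 - v) = v by omega]
    exact h1.apply_block hp

/-! ### Bounds on the number of occurrences -/

/-- The number of clauses in which a variable appears. -/
def occurrences (v : ℕ) (cs : List (List (ℕ × Bool))) : ℕ :=
  cs.countP fun c => decide (v ∈ c.map Prod.fst)

theorem occurrences_append (v : ℕ) (cs ds : List (List (ℕ × Bool))) :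
    occurrences v (cs ++ ds) = occurrences v cs + occurrences v ds :=
  List.countP_append

/-- Consecutive gadgets share one variable, which is in at most one clause of the earlier and two of
the later gadget. The variables used by links are in at most one gadget clause. -/
theorem occurrences_gadget (v u : ℕ) (i : Item) :
    occurrences v (gadget u i) ≤ 3 ∧ (v < u → occurrences v (gadget u i) = 0) ∧
      (v = u → occurrences v (gadget u i) ≤ 2) ∧
      (v = u + 1 ∨ v = u + 4 ∨ v = u + 5 ∨ v = u + 8 → occurrences v (gadget u i) ≤ 1) ∧
      (u + 8 < v → occurrences v (gadget u i) = 0) := by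
  rcases i with _ | ⟨w, b⟩ <;>
    simp only [gadget, occurrences, List.countP_cons, List.countP_nil, List.map_cons, List.map_nil,
      List.mem_cons, List.not_mem_nil, or_false, decide_eq_true_eq]
  · split_ifs <;> omega
  · split_ifs <;> omega

theorem occurrences_gadgets_eq_zero {v u : ℕ} (h : v < u) (is : List Item) :
    occurrences v (gadgets u is) = 0 := by
  induction is generalizing u with
  | nil => rfl
  | cons i is ih =>
    rw [gadgets, occurrences_append, ih (by omega), (occurrences_gadget v u i).2.1 h]

theorem occurrences_gadgets_start (u : ℕ) (is : List Item) :
    occurrences u (gadgets u is) ≤ 2 := by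
  cases is with
  | nil => simp [gadgets, occurrences]
  | cons i is =>
    rw [gadgets, occurrences_append, occurrences_gadgets_eq_zero (by omega), zero_add]
    exact (occurrences_gadget u u i).2.2.1 rfl

theorem occurrences_gadgets_le (v u : ℕ) (is : List Item) : occurrences v (gadgets u is) ≤ 3 := by
  induction is generalizing u with
  | nil => simp [gadgets, occurrences]
  | cons i is ih =>
    rw [gadgets, occurrences_append]
    obtain ⟨h1, -, -, h4, h5⟩ := occurrences_gadget v u i
    rcases lt_trichotomy v (u + 8) with h | h | h
    · rw [occurrences_gadgets_eq_zero h]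
      omega
    · have := occurrences_gadgets_start (u + 8) is
      rw [← h] at this
      rw [← h]
      omega
    · have := ih (u + 8)
      omega

theorem occurrences_gadgets_copy {v u p j : ℕ} (hj : j = 1 ∨ j = 4 ∨ j = 5)
    (hv : v = u + 8 * p + j) (is : List Item) : occurrences v (gadgets u is) ≤ 1 := by
  induction is generalizing u p with
  | nil => simp [gadgets, occurrences]
  | cons i is ih =>
    rw [gadgets, occurrences_append]
    obtain ⟨h1, -, -, h4, h5⟩ := occurrences_gadget v u i
    rcases p with _ | p
    · rw [occurrences_gadgets_eq_zero (by omega)]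
      omega
    · have := ih (u := u + 8) (p := p) (by omega)
      omega

theorem occurrences_link (v last u : ℕ) (h : last < u) :
    occurrences v (link last u) ≤ 2 ∧
      (v = last ∨ v = u + 1 → occurrences v (link last u) ≤ 1) ∧
      (v ≠ last → v ≠ u + 1 → v ≠ u + 4 → v ≠ u + 5 → occurrences v (link last u) = 0) := by
  simp only [link, occurrences, List.countP_cons, List.countP_nil, List.map_cons, List.map_nil,
    List.mem_cons, List.not_mem_nil, or_false, decide_eq_true_eq]
  split_ifs <;> omega

/-- Only the first link of a chain uses `last`; the later ones start from the previous copy. -/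
theorem occurrences_links_of_lt {v last u : ℕ} (h : last < u) (hv : v < u) (is : List Item) :
    occurrences v (links last u is) ≤ 1 ∧
      (v ≠ last → occurrences v (links last u is) = 0) := by
  induction is generalizing last u with
  | nil => simp [links, occurrences]
  | cons i is ih =>
    rcases i with _ | ⟨_ | w, b⟩
    · exact ih (by omega) (by omega)
    · rw [links, occurrences_append]
      obtain ⟨h1, h2, h3⟩ := occurrences_link v last u h
      have := ih (last := u + 1) (u := u + 8) (by omega) (by omega)
      omega
    · exact ih (by omega) (by omega)

/-- A copy is in one clause of the link to its predecessor and in one of the link to its successor;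
the offsets 4 and 5 are in the two clauses of a single link. -/
theorem occurrences_links {v last u p j : ℕ} (h : last < u) (hj : j < 8)
    (hv : v = u + 8 * p + j) (is : List Item) :
    occurrences v (links last u is) ≤ 2 ∧
      (¬ ((j = 1 ∨ j = 4 ∨ j = 5) ∧ ∃ b, is[p]? = some (some (0, b))) →
        occurrences v (links last u is) = 0) := by
  induction is generalizing last u p with
  | nil => simp [links, occurrences]
  | cons i is ih =>
    rcases p with _ | p
    · rcases i with _ | ⟨_ | w, b⟩
      · rw [links]
        have := occurrences_links_of_lt (v := v) (last := last) (u := u + 8) (by omega)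
          (by omega) is
        exact ⟨by omega, fun _ => this.2 (by omega)⟩
      · rw [links, occurrences_append]
        obtain ⟨h1, h2, h3⟩ := occurrences_link v last u h
        have := occurrences_links_of_lt (v := v) (last := u + 1) (u := u + 8) (by omega)
          (by omega) is
        refine ⟨by omega, fun hn => ?_⟩
        have hn' : ¬ (j = 1 ∨ j = 4 ∨ j = 5) := fun hj => hn ⟨hj, b, rfl⟩
        omega
      · rw [links]
        have := occurrences_links_of_lt (v := v) (last := last) (u := u + 8) (by omega)
          (by omega) is
        exact ⟨by omega, fun _ => this.2 (by omega)⟩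
    · rw [List.getElem?_cons_succ]
      rcases i with _ | ⟨_ | w, b⟩
      · exact ih (by omega) (by omega)
      · rw [links, occurrences_append]
        obtain ⟨h1, h2, h3⟩ := occurrences_link v last u h
        rw [h3 (by omega) (by omega) (by omega) (by omega)]
        exact ih (by omega) (by omega)
      · exact ih (by omega) (by omega)

theorem occurrences_rounds_of_lt {v n k : ℕ} (hk : k ≤ n) (hv : v < n) (is : List Item) :
    occurrences v (rounds n k is) ≤ 1 ∧ (k ≤ v → occurrences v (rounds n k is) = 0) := by
  induction k generalizing is with
  | zero => simp [rounds, occurrences]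
  | succ k ih =>
    rw [rounds, occurrences_append]
    have h1 := ih (by omega) (is.map strike)
    have h2 := occurrences_links_of_lt (v := v) (last := k) (u := n) (by omega) hv is
    omega

/-- At most one round contributes: a literal that has been linked is struck and never has index zero
again. -/
theorem occurrences_rounds {v n k p j : ℕ} (hk : k ≤ n) (hj : j < 8)
    (hv : v = n + 8 * p + j) (is : List Item) :
    occurrences v (rounds n k is) ≤ 2 ∧
      (¬ ((j = 1 ∨ j = 4 ∨ j = 5) ∧ ∃ l, is[p]? = some (some l)) →
        occurrences v (rounds n k is) = 0) := by
  induction k generalizing is with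
  | zero => simp [rounds, occurrences]
  | succ k ih =>
    rw [rounds, occurrences_append]
    obtain ⟨h1, h2⟩ := ih (by omega) (is.map strike)
    obtain ⟨h3, h4⟩ := occurrences_links (v := v) (last := k) (u := n) (by omega) hj hv is
    by_cases hc : (j = 1 ∨ j = 4 ∨ j = 5) ∧ ∃ b, is[p]? = some (some (0, b))
    · obtain ⟨hj', b, hb⟩ := hc
      rw [h2 (by simp [hb, strike])]
      exact ⟨by omega, fun hn => absurd ⟨hj', _, hb⟩ hn⟩
    · rw [h4 hc]
      refine ⟨by omega, fun hn => ?_⟩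
      rw [h2]
      rintro ⟨hj', l, hl⟩
      refine hn ⟨hj', ?_⟩
      rw [List.getElem?_map] at hl
      match hi : is[p]? with
      | none => simp [hi] at hl
      | some none => simp [hi, strike] at hl
      | some (some l) => exact ⟨l, rfl⟩

theorem occurrences_reductionClauses (v n : ℕ) (is : List Item) :
    occurrences v (reductionClauses n is) ≤ 4 := by
  rw [reductionClauses, occurrences_append]
  have h3 := occurrences_gadgets_le v n is
  rcases lt_or_ge v n with h | h
  · have := (occurrences_rounds_of_lt le_rfl h is).1
    omega
  · obtain ⟨p, j, hj, hv⟩ : ∃ p j, j < 8 ∧ v = n + 8 * p + j :=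
      ⟨(v - n) / 8, (v - n) % 8, Nat.mod_lt _ (by omega), by omega⟩
    obtain ⟨h1, h2⟩ := occurrences_rounds le_rfl hj hv is
    by_cases hj' : j = 1 ∨ j = 4 ∨ j = 5
    · have := occurrences_gadgets_copy hj' hv is
      omega
    · rw [h2 fun h => hj' h.1]
      omega

/-! ### The shape of the clauses -/

/-- A clause of three literals on distinct variables below `N`. -/
def IsTriple (N : ℕ) (c : List (ℕ × Bool)) : Prop :=
  c.length = 3 ∧ (c.map Prod.fst).Nodup ∧ ∀ l ∈ c, l.1 < N

theorem isTriple_gadgets {N u : ℕ} {is : List Item} (h : u + 8 * is.length < N) :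
    ∀ c ∈ gadgets u is, IsTriple N c := by
  induction is generalizing u with
  | nil => simp [gadgets]
  | cons i is ih =>
    rw [List.length_cons] at h
    intro c hc
    rw [gadgets, List.mem_append] at hc
    rcases hc with hc | hc
    · exact ih (by omega) c hc
    · rcases i with _ | ⟨v, b⟩
      · simp only [gadget, List.mem_cons, List.not_mem_nil, or_false] at hc
        rcases hc with rfl | rfl | rfl <;> simp [IsTriple] <;> omega
      · simp only [gadget, List.mem_cons, List.not_mem_nil, or_false] at hc
        rcases hc with rfl | rfl <;> simp [IsTriple] <;> omega

theorem isTriple_links {N last u : ℕ} {is : List Item} (hl : last < u)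
    (h : u + 8 * is.length < N) : ∀ c ∈ links last u is, IsTriple N c := by
  induction is generalizing last u with
  | nil => simp [links]
  | cons i is ih =>
    rw [List.length_cons] at h
    rcases i with _ | ⟨_ | v, b⟩
    · exact ih (by omega) (by omega)
    · intro c hc
      rw [links, List.mem_append] at hc
      rcases hc with hc | hc
      · exact ih (by omega) (by omega) c hc
      · simp only [link, List.mem_cons, List.not_mem_nil, or_false] at hc
        rcases hc with rfl | rfl <;> simp [IsTriple] <;> omega
    · exact ih (by omega) (by omega)

theorem isTriple_rounds {N n k : ℕ} {is : List Item} (hk : k ≤ n)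
    (h : n + 8 * is.length < N) : ∀ c ∈ rounds n k is, IsTriple N c := by
  induction k generalizing is with
  | zero => simp [rounds]
  | succ k ih =>
    intro c hc
    rw [rounds, List.mem_append] at hc
    rcases hc with hc | hc
    · exact ih (by omega) (by simpa using h) c hc
    · exact isTriple_links (by omega) h c hc

theorem isTriple_reductionClauses {N n : ℕ} {is : List Item} (h : n + 8 * is.length < N) :
    ∀ c ∈ reductionClauses n is, IsTriple N c := by
  intro c hc
  rw [reductionClauses, List.mem_append] at hc
  exact hc.elim (isTriple_rounds le_rfl h c) (isTriple_gadgets h c)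

/-! ### The reduction on formulas -/

/-- The clauses of a formula, with natural numbers as variables. -/
def Formula.natClauses (φ : Formula) : List (List (ℕ × Bool)) :=
  φ.clauses.map (List.map fun l => (l.1.val, l.2))

/-- The items of a formula. -/
def Formula.items (φ : Formula) : List Item := formulaItems φ.natClauses

/-- The (3,4)-XSAT instance that is equivalent to the 3-SAT instance `φ`. -/
def Formula.reduce (φ : Formula) : Formula where
  numVars := φ.numVars + 8 * φ.items.length + 1
  clauses := (reductionClauses φ.numVars φ.items).map
    (List.map fun l => (Fin.ofNat (φ.numVars + 8 * φ.items.length + 1) l.1, l.2))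

/-- All indices are below the number of variables, so the reduction modulo that number in
`Fin.ofNat` changes nothing. -/
theorem Formula.natClauses_reduce (φ : Formula) :
    φ.reduce.natClauses = reductionClauses φ.numVars φ.items := by
  have h := isTriple_reductionClauses (N := φ.numVars + 8 * φ.items.length + 1)
    (n := φ.numVars) (is := φ.items) (by omega)
  rw [natClauses, reduce, List.map_map]
  refine (List.map_congr_left fun c hc => ?_).trans (List.map_id _)
  rw [Function.comp_apply, List.map_map]
  refine (List.map_congr_left fun l hl => ?_).trans (List.map_id _)
  exact Prod.ext (Nat.mod_eq_of_lt ((h c hc).2.2 l hl)) rfl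

theorem Formula.satisfiable_iff (φ : Formula) :
    φ.Satisfiable ↔ ∃ α : ℕ → Bool, ∀ c ∈ φ.natClauses, ∃ l ∈ c, α l.1 = l.2 := by
  rw [Satisfiable, natClauses]
  constructor
  · rintro ⟨a, ha⟩
    refine ⟨fun v => if h : v < φ.numVars then a ⟨v, h⟩ else false,
      List.forall_mem_map.2 fun c hc => ?_⟩
    obtain ⟨l, hl, h⟩ := ha c hc
    exact ⟨_, List.mem_map_of_mem hl, by simpa using h⟩
  · rintro ⟨α, hα⟩
    refine ⟨fun v => α v, fun c hc => ?_⟩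
    obtain ⟨_, hl, h⟩ := hα _ (List.mem_map_of_mem hc)
    obtain ⟨l, hl', rfl⟩ := List.mem_map.1 hl
    exact ⟨l, hl', h⟩

theorem Formula.exactlyOneSatisfiable_iff (φ : Formula) :
    φ.ExactlyOneSatisfiable ↔ ∃ A, ExactlyOneSat A φ.natClauses := by
  simp only [ExactlyOneSatisfiable, natClauses, ExactlyOneSat, List.forall_mem_map,
    List.countP_map]
  constructor
  · rintro ⟨a, ha⟩
    refine ⟨fun v => if h : v < φ.numVars then a ⟨v, h⟩ else false, fun c hc => ?_⟩
    simpa [Function.comp_def] using ha c hc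
  · rintro ⟨α, hα⟩
    exact ⟨fun v => α v, hα⟩

theorem Formula.exactlyOneSatisfiable_reduce (φ : Formula) :
    φ.reduce.ExactlyOneSatisfiable ↔ φ.Satisfiable := by
  rw [exactlyOneSatisfiable_iff, natClauses_reduce, satisfiable_iff]
  refine exists_exactlyOneSat_iff ?_
  simp only [natClauses, List.forall_mem_map]
  exact fun c _ l _ => l.1.isLt

theorem Formula.isThreeFour_reduce (φ : Formula) : φ.reduce.IsThreeFour := by
  have h := isTriple_reductionClauses (N := φ.numVars + 8 * φ.items.length + 1)
    (n := φ.numVars) (is := φ.items) (by omega)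
  rw [← natClauses_reduce] at h
  simp only [natClauses, List.forall_mem_map, IsTriple, List.length_map, List.map_map] at h
  refine ⟨fun c hc => ⟨(h c hc).1, ?_⟩, fun v => ?_⟩
  · have := (h c hc).2.1
    refine List.Nodup.of_map Fin.val ?_
    rwa [List.map_map]
  · have := occurrences_reductionClauses v φ.numVars φ.items
    rw [← natClauses_reduce, occurrences, natClauses, List.countP_map] at this
    refine le_trans (le_of_eq ?_) this
    congr 1
    funext c
    rw [Function.comp_apply, decide_eq_decide, List.map_map,
      show (Prod.fst ∘ fun l : Fin φ.reduce.numVars × Bool => (l.1.val, l.2)) =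
        Fin.val ∘ Prod.fst from rfl, ← List.map_map, List.mem_map_of_injective Fin.val_injective]

/-- A clause gives at most three literals and one end; the additional item is the leading end. -/
theorem Formula.length_items_le {φ : Formula} (h : φ.IsThreeCNF) :
    φ.items.length ≤ 4 * φ.numClauses + 1 := by
  have key : ∀ cs : List (List (Fin φ.numVars × Bool)), (∀ c ∈ cs, c.length ≤ 3) →
      ((cs.map (List.map fun l => (l.1.val, l.2))).flatMap clauseItems).length ≤
        4 * cs.length := by
    intro cs hcs
    induction cs with
    | nil => simp
    | cons c cs ih =>
      rw [List.forall_mem_cons] at hcs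
      have := ih hcs.2
      simp only [List.map_cons, List.flatMap_cons, List.length_append, clauseItems,
        List.length_map, List.length_cons, List.length_nil] at this ⊢
      omega
  have := key φ.clauses h
  rw [items, formulaItems, List.length_cons]
  exact Nat.add_le_add_right this 1

/-! ### Upper bounds for running times, and words as sequences of items -/

/-- `p` goes from `s` to `s'` in at most `B` steps. -/
def Steps (p : Prog) (s s' : Store) (B : ℕ) : Prop := ∃ t ≤ B, Runs p s s' t

namespace Steps

variable {p q : Prog} {s s₁ s₂ : Store} {k : Reg} {P : Option Symbol → Bool} {B B₁ B₂ : ℕ}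

theorem mono (h : Steps p s s₁ B₁) (hB : B₁ ≤ B₂) : Steps p s s₁ B₂ :=
  let ⟨t, ht, hr⟩ := h
  ⟨t, ht.trans hB, hr⟩

theorem push (k : Reg) (a : Symbol) (s : Store) :
    Steps (.push k a) s (s.set k (a :: s.get k)) 1 :=
  ⟨1, le_rfl, .push k a s⟩

theorem pop (k : Reg) (s : Store) : Steps (.pop k) s (s.set k (s.get k).tail) 1 :=
  ⟨1, le_rfl, .pop k s⟩

theorem move (k k' : Reg) (s : Store) (a : Symbol) (l : List Symbol) (h : s.get k = a :: l) :
    Steps (.move k k') s ((s.set k l).set k' (a :: (s.set k l).get k')) 1 :=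
  ⟨1, le_rfl, .move k k' s a l h⟩

theorem seq (h₁ : Steps p s s₁ B₁) (h₂ : Steps q s₁ s₂ B₂) :
    Steps (.seq p q) s s₂ (B₁ + B₂) :=
  let ⟨_, ht₁, hr₁⟩ := h₁
  let ⟨_, ht₂, hr₂⟩ := h₂
  ⟨_, by omega, .seq hr₁ hr₂⟩

theorem ite_true (h : P (s.get k).head? = true) (h₁ : Steps p s s₁ B) :
    Steps (.ite k P p q) s s₁ (B + 1) :=
  let ⟨_, ht₁, hr₁⟩ := h₁
  ⟨_, by omega, .ite_true h hr₁⟩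

theorem ite_false (h : P (s.get k).head? = false) (h₁ : Steps q s s₁ B) :
    Steps (.ite k P p q) s s₁ (B + 1) :=
  let ⟨_, ht₁, hr₁⟩ := h₁
  ⟨_, by omega, .ite_false h hr₁⟩

theorem loop_true (h : P (s.get k).head? = true) (h₁ : Steps p s s₁ B₁)
    (h₂ : Steps (.loop k P p) s₁ s₂ B₂) : Steps (.loop k P p) s s₂ (B₁ + B₂ + 1) :=
  let ⟨_, ht₁, hr₁⟩ := h₁
  let ⟨_, ht₂, hr₂⟩ := h₂
  ⟨_, by omega, .loop_true h hr₁ hr₂⟩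

theorem loop_false (h : P (s.get k).head? = false) : Steps (.loop k P p) s s 1 :=
  ⟨1, le_rfl, .loop_false h⟩

end Steps

/-- This bounds the length of the output by the running time, without a separate count. -/
theorem Runs.length_get_le {p : Prog} {s s' : Store} {t : ℕ} (h : Runs p s s' t) (r : Reg) :
    (s'.get r).length ≤ (s.get r).length + t := by
  induction h with
  | push k a s =>
    rw [Store.get_set]
    by_cases hr : r = k
    · subst hr
      simp
    · simp [hr]
  | pop k s =>
    rw [Store.get_set]
    by_cases hr : r = k
    · subst hr
      simp
      omega
    · simp [hr]
  | move k k' s a l h =>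
    have h1 : ((s.set k l).get r).length ≤ (s.get r).length := by
      rw [Store.get_set]
      by_cases hr : r = k
      · subst hr
        simp [h]
      · simp [hr]
    rw [Store.get_set]
    by_cases hr : r = k'
    · subst hr
      simpa using h1
    · rw [Function.update_of_ne hr]
      omega
  | seq _ _ ih₁ ih₂ => omega
  | ite_true _ _ ih => omega
  | ite_false _ _ ih => omega
  | loop_true _ _ _ ih₁ ih₂ => omega
  | loop_false _ => omega

/-- The number `n` in unary. -/
abbrev ticks (n : ℕ) : List Symbol := List.replicate n Symbol.tick

def isTick (a : Option Symbol) : Bool := a == some .tick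

def isMark (a : Option Symbol) : Bool := a == some .mark

def isPos (a : Option Symbol) : Bool := a == some .pos

def signSymbol (b : Bool) : Symbol := if b then .pos else .neg

def literalWord (l : ℕ × Bool) : List Symbol := ticks l.1 ++ [signSymbol l.2]

def clauseWord (c : List (ℕ × Bool)) : List Symbol := c.flatMap literalWord ++ [.mark]

def itemWord : Item → List Symbol
  | none => [.mark]
  | some l => literalWord l

theorem Formula.flatMap_clauseWord_natClauses (φ : Formula) :
    φ.natClauses.flatMap clauseWord = φ.clauses.flatMap encodeClause := by
  rw [natClauses, List.flatMap_map]
  congr 1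
  funext c
  rw [clauseWord, encodeClause, List.flatMap_map]
  rfl

theorem encodeFormula_eq (φ : Formula) :
    encodeFormula φ = ticks φ.numVars ++ .mark :: φ.natClauses.flatMap clauseWord := by
  rw [encodeFormula, φ.flatMap_clauseWord_natClauses, List.append_assoc, List.singleton_append]

/-- The mark after the number of variables is read as the leading end of a clause. -/
theorem encodeFormula_eq_items (φ : Formula) :
    encodeFormula φ = ticks φ.numVars ++ φ.items.flatMap itemWord := by
  rw [encodeFormula_eq, Formula.items, formulaItems, List.flatMap_cons, List.flatMap_assoc]
  congr 3
  funext c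
  simp [clauseWord, clauseItems, itemWord, List.flatMap_map]

/-! ### Programs that write literals, clauses and gadgets -/

/-- Push a copy of the counter `k` on `k'`. -/
def copyProg (k k' : Reg) : Prog :=
  .seq (.loop k isTick (.seq (.push k' .tick) (.move k .tmp)))
    (.loop .tmp isTick (.move .tmp k))

/-- The function `S` inserts the contents of `k`, `k'` and `tmp` into a store. -/
structure IsStoreOf (k k' : Reg) (S : List Symbol → List Symbol → List Symbol → Store) :
    Prop where
  get_fst : ∀ x y z, (S x y z).get k = x
  get_snd : ∀ x y z, (S x y z).get k' = y
  get_tmp : ∀ x y z, (S x y z).get .tmp = z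
  set_fst : ∀ x y z w, (S x y z).set k w = S w y z
  set_snd : ∀ x y z w, (S x y z).set k' w = S x w z
  set_tmp : ∀ x y z w, (S x y z).set .tmp w = S x y w

/-- Each tick costs three steps on the way to `tmp` and two on the way back; the final tests of the
two loops give the constant. -/
theorem steps_copyProg {k k' : Reg} {S : List Symbol → List Symbol → List Symbol → Store}
    (hS : IsStoreOf k k' S) (b : ℕ) (y : List Symbol) :
    Steps (copyProg k k') (S (ticks b) y []) (S (ticks b) (ticks b ++ y) []) (5 * b + 2) := by
  have h1 : ∀ b z y, Steps (.loop k isTick (.seq (.push k' .tick) (.move k .tmp)))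
      (S (ticks b) y (ticks z)) (S [] (ticks b ++ y) (ticks (b + z))) (3 * b + 1) := by
    intro b
    induction b with
    | zero =>
      intro z y
      rw [zero_add]
      exact .loop_false (by rw [hS.get_fst]; rfl)
    | succ b ih =>
      intro z y
      have h := ih (z + 1) (.tick :: y)
      rw [show ticks b ++ .tick :: y = ticks (b + 1) ++ y by
        simp [ticks, List.replicate_succ'], show b + (z + 1) = b + 1 + z by ring] at h
      refine (Steps.loop_true (by rw [hS.get_fst]; rfl)
        ((Steps.push _ _ _).seq (Steps.move _ _ _ .tick (ticks b) ?_)) ?_).mono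
          (B₁ := 1 + 1 + (3 * b + 1) + 1) (by omega)
      · rw [hS.get_snd, hS.set_snd, hS.get_fst]
        rfl
      · rw [hS.get_snd, hS.set_snd, hS.set_fst, hS.get_tmp, hS.set_tmp]
        exact h
  have h2 : ∀ z b y, Steps (.loop .tmp isTick (.move .tmp k))
      (S (ticks b) y (ticks z)) (S (ticks (b + z)) y []) (2 * z + 1) := by
    intro z
    induction z with
    | zero =>
      intro b y
      exact .loop_false (by rw [hS.get_tmp]; rfl)
    | succ z ih =>
      intro b y
      have h := ih (b + 1) y
      rw [show b + 1 + z = b + (z + 1) by ring] at h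
      refine (Steps.loop_true (by rw [hS.get_tmp]; rfl)
        (Steps.move _ _ _ .tick (ticks z) (by rw [hS.get_tmp]; rfl)) ?_).mono
          (B₁ := 1 + (2 * z + 1) + 1) (by omega)
      rw [hS.set_tmp, hS.get_fst, hS.set_fst]
      exact h
  have h := (h1 b 0 y).seq (h2 b 0 (ticks b ++ y))
  rw [zero_add] at h
  exact h.mono (by omega)

/-- `p` pushes the word `w` on the register `out`. -/
def Emits (p : Prog) (S : List Symbol → Store) (w : List Symbol) (B : ℕ) : Prop :=
  ∀ o, Steps p (S o) (S (w ++ o)) B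

theorem Emits.seq {p q : Prog} {S : List Symbol → Store} {w w' : List Symbol} {B B' : ℕ}
    (h : Emits p S w B) (h' : Emits q S w' B') : Emits (.seq p q) S (w' ++ w) (B + B') := by
  intro o
  rw [List.append_assoc]
  exact (h o).seq (h' (w ++ o))

/-- Push a literal whose index is the counter `k`, increased by `j`. -/
def emitLiteral (k : Reg) : ℕ → Bool → Prog
  | 0, b => .seq (.push .out (signSymbol b)) (copyProg k .out)
  | j + 1, b => .seq (emitLiteral k j b) (.push .out .tick)

theorem emits_emitLiteral {k : Reg} {S : List Symbol → Store} {u : ℕ}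
    (hS : ∃ S' : List Symbol → List Symbol → List Symbol → Store,
      IsStoreOf k .out S' ∧ S = fun o => S' (ticks u) o []) (j : ℕ) (b : Bool) :
    Emits (emitLiteral k j b) S (literalWord (u + j, b)) (5 * u + j + 3) := by
  obtain ⟨S', hS', rfl⟩ := hS
  induction j with
  | zero =>
    intro o
    have h := steps_copyProg hS' u (signSymbol b :: o)
    have h' := Steps.push .out (signSymbol b) (S' (ticks u) o [])
    rw [hS'.get_snd, hS'.set_snd] at h'
    have := (h'.seq h).mono (show _ ≤ 5 * u + 0 + 3 by omega)
    simpa [literalWord, emitLiteral] using this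
  | succ j ih =>
    intro o
    have h' := Steps.push .out .tick (S' (ticks u) (literalWord (u + j, b) ++ o) [])
    rw [hS'.get_snd, hS'.set_snd] at h'
    exact ((ih o).seq h').mono (by omega)

/-- The output is a stack, so a clause is written from its end; the gadgets are likewise written
last clause first. -/
def emitClause (p₁ p₂ p₃ : Prog) : Prog :=
  .seq (.push .out .mark) (.seq p₃ (.seq p₂ p₁))

theorem emits_emitClause {p₁ p₂ p₃ : Prog} {S : List Symbol → Store} {l₁ l₂ l₃ : ℕ × Bool}
    {B : ℕ} (hS : ∀ o, (S o).get .out = o ∧ ∀ o', (S o).set .out o' = S o')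
    (h₁ : Emits p₁ S (literalWord l₁) B) (h₂ : Emits p₂ S (literalWord l₂) B)
    (h₃ : Emits p₃ S (literalWord l₃) B) :
    Emits (emitClause p₁ p₂ p₃) S (clauseWord [l₁, l₂, l₃]) (3 * B + 1) := by
  have h : Emits (.push .out .mark) S [.mark] 1 := by
    intro o
    have := Steps.push .out .mark (S o)
    rwa [(hS o).1, (hS o).2] at this
  have := h.seq (h₃.seq (h₂.seq h₁))
  intro o
  have h := (this o).mono (show _ ≤ 3 * B + 1 by omega)
  simpa [clauseWord, emitClause] using h

def emitGadgetNone : Prog :=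
  .seq (emitClause (emitLiteral .base 8 true) (emitLiteral .base 6 true)
    (emitLiteral .base 7 true)) <|
  .seq (emitClause (emitLiteral .base 0 false) (emitLiteral .base 6 false)
    (emitLiteral .base 7 false))
  (emitClause (emitLiteral .base 0 false) (emitLiteral .base 6 true) (emitLiteral .base 7 true))

def emitGadgetSome (b : Bool) : Prog :=
  .seq (emitClause (emitLiteral .base 8 false) (emitLiteral .base 0 true)
    (emitLiteral .base 2 true))
  (emitClause (emitLiteral .base 2 true) (emitLiteral .base 3 true) (emitLiteral .base 1 !b))

def emitLink : Prog :=
  .seq (emitClause (emitLiteral .base 1 true) (emitLiteral .base 4 true)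
    (emitLiteral .base 5 true))
  (emitClause (emitLiteral .last 0 true) (emitLiteral .base 4 true) (emitLiteral .base 5 true))

section Emit

variable (i a c : List Symbol) (u l : ℕ)

theorem emits_base (j : ℕ) (b : Bool) (hj : j ≤ 8) :
    Emits (emitLiteral .base j b) (fun o => ⟨i, a, ticks u, [], c, ticks l, o⟩)
      (literalWord (u + j, b)) (5 * u + 11) := by
  intro o
  refine (emits_emitLiteral (S := fun o => ⟨i, a, ticks u, [], c, ticks l, o⟩)
    ⟨fun x y z => ⟨i, a, x, z, c, ticks l, y⟩, ?_, rfl⟩ j b o).mono (by omega)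
  constructor <;> intros <;> rfl

theorem emits_last (b : Bool) :
    Emits (emitLiteral .last 0 b) (fun o => ⟨i, a, ticks u, [], c, ticks l, o⟩)
      (literalWord (l, b)) (5 * l + 3) := by
  refine emits_emitLiteral (S := fun o => ⟨i, a, ticks u, [], c, ticks l, o⟩)
    ⟨fun x y z => ⟨i, a, ticks u, z, c, x, y⟩, ?_, rfl⟩ 0 b
  constructor <;> intros <;> rfl

theorem emits_emitGadgetNone :
    Emits emitGadgetNone (fun o => ⟨i, a, ticks u, [], c, ticks l, o⟩)
      ((gadget u none).flatMap clauseWord) (45 * u + 102) := by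
  have h := fun j b hj => emits_base i a c u l j b hj
  have hS : ∀ o, (Store.mk i a (ticks u) [] c (ticks l) o).get .out = o ∧
      ∀ o', (Store.mk i a (ticks u) [] c (ticks l) o).set .out o' =
        ⟨i, a, ticks u, [], c, ticks l, o'⟩ := fun _ => ⟨rfl, fun _ => rfl⟩
  intro o
  have := (((emits_emitClause hS (h 8 true (by omega)) (h 6 true (by omega))
    (h 7 true (by omega))).seq ((emits_emitClause hS (h 0 false (by omega))
    (h 6 false (by omega)) (h 7 false (by omega))).seq (emits_emitClause hS
    (h 0 false (by omega)) (h 6 true (by omega)) (h 7 true (by omega))))) o).mono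
    (show _ ≤ 45 * u + 102 by omega)
  simpa [gadget, emitGadgetNone] using this

theorem emits_emitGadgetSome (v : ℕ) (b : Bool) :
    Emits (emitGadgetSome b) (fun o => ⟨i, a, ticks u, [], c, ticks l, o⟩)
      ((gadget u (some (v, b))).flatMap clauseWord) (45 * u + 102) := by
  have h := fun j b hj => emits_base i a c u l j b hj
  have hS : ∀ o, (Store.mk i a (ticks u) [] c (ticks l) o).get .out = o ∧
      ∀ o', (Store.mk i a (ticks u) [] c (ticks l) o).set .out o' =
        ⟨i, a, ticks u, [], c, ticks l, o'⟩ := fun _ => ⟨rfl, fun _ => rfl⟩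
  intro o
  have := (((emits_emitClause hS (h 8 false (by omega)) (h 0 true (by omega))
    (h 2 true (by omega))).seq (emits_emitClause hS (h 2 true (by omega))
    (h 3 true (by omega)) (h 1 (!b) (by omega)))) o).mono
    (show _ ≤ 45 * u + 102 by omega)
  simpa [gadget, emitGadgetSome] using this

theorem emits_emitLink {Z : ℕ} (hu : u ≤ Z) (hl : l ≤ Z) :
    Emits emitLink (fun o => ⟨i, a, ticks u, [], c, ticks l, o⟩)
      ((link l u).flatMap clauseWord) (45 * Z + 102) := by
  have h := fun j b hj o => (emits_base i a c u l j b hj o).mono (show _ ≤ 5 * Z + 11 by omega)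
  have h' := fun o => (emits_last i a c u l true o).mono (show _ ≤ 5 * Z + 11 by omega)
  have hS : ∀ o, (Store.mk i a (ticks u) [] c (ticks l) o).get .out = o ∧
      ∀ o', (Store.mk i a (ticks u) [] c (ticks l) o).set .out o' =
        ⟨i, a, ticks u, [], c, ticks l, o'⟩ := fun _ => ⟨rfl, fun _ => rfl⟩
  intro o
  have := (((emits_emitClause hS (h 1 true (by omega)) (h 4 true (by omega))
    (h 5 true (by omega))).seq (emits_emitClause hS h'
    (h 4 true (by omega)) (h 5 true (by omega)))) o).mono
    (show _ ≤ 45 * Z + 102 by omega)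
  simpa [link, emitLink] using this

end Emit

/-! ### The passes over the items -/

/-- Append a program to `j` copies of another one. -/
def repeatProg (p : Prog) : ℕ → Prog
  | 0 => p
  | j + 1 => .seq p (repeatProg p j)

/-- Advance the counter `base` to the next block. -/
def nextBlock : Prog := repeatProg (.push .base .tick) 7

def previousBlock : Prog := repeatProg (.pop .base) 7

/-- Move the ticks on the top of `inp` to `aux`. -/
def moveTicks : Prog := .loop .inp isTick (.move .inp .aux)

/-- Emit the gadgets of all items, and move the items to `aux`. -/
def gadgetPass : Prog :=
  .loop .inp Option.isSome <|
    .seq moveTicks <|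
    .seq (.ite .inp isMark emitGadgetNone
      (.ite .inp isPos (emitGadgetSome true) (emitGadgetSome false))) <|
    .seq (.move .inp .aux) nextBlock

def clearLast : Prog := .loop .last isTick (.pop .last)

/-- Emit the links of one round, and move the items to `aux` while decreasing their indices. -/
def linkPass : Prog :=
  .loop .inp Option.isSome <|
    .seq (.ite .inp isTick
      (.seq (.pop .inp) (.seq moveTicks (.move .inp .aux)))
      (.ite .inp isMark (.move .inp .aux)
        (.seq emitLink <| .seq clearLast <| .seq (copyProg .base .last) <|
          .seq (.push .last .tick) <| .seq (.pop .inp) (.push .aux .mark))))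
    nextBlock

/-- Move the items back to `inp`. -/
def restorePass : Prog :=
  .loop .aux Option.isSome <|
    .ite .aux isTick (.move .aux .inp) (.seq (.move .aux .inp) previousBlock)

def roundProg : Prog :=
  .seq (copyProg .cnt .last) <| .seq linkPass <| .seq clearLast restorePass

def roundsProg : Prog := .loop .cnt isTick (.seq (.pop .cnt) roundProg)

/-- Move the number of variables to `base` and to `cnt`. -/
def parseProg : Prog :=
  .loop .inp isTick (.seq (.push .cnt .tick) (.move .inp .base))

/-- Remove the items, and advance `base` to the end. -/
def clearPass : Prog :=
  .loop .inp Option.isSome (.ite .inp isTick (.pop .inp) (.seq (.pop .inp) nextBlock))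

/-- Emit the number of variables. -/
def emitHeader : Prog :=
  .seq (.push .out .mark) <| .seq (.push .out .tick) (.loop .base isTick (.move .base .out))

/-- The reduction, except that the output is left on `out`. -/
def reduceToOut : Prog :=
  .seq parseProg <| .seq gadgetPass <| .seq restorePass <| .seq roundsProg <|
    .seq clearPass emitHeader

/-- The reduction from 3-SAT to (3,4)-XSAT. -/
def reduceProg : Prog :=
  .seq reduceToOut (.loop .out Option.isSome (.move .out .aux))

theorem ticks_append_cons (b : ℕ) (l : List Symbol) :
    ticks b ++ .tick :: l = ticks (b + 1) ++ l := by
  simp [ticks, List.replicate_succ']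

section Passes

variable (i a c l o : List Symbol) (t : List Symbol)

theorem steps_nextBlock (u : ℕ) :
    Steps nextBlock ⟨i, a, ticks u, t, c, l, o⟩ ⟨i, a, ticks (u + 8), t, c, l, o⟩ 8 :=
  (((Steps.push _ _ _).seq ((Steps.push _ _ _).seq ((Steps.push _ _ _).seq
    ((Steps.push _ _ _).seq ((Steps.push _ _ _).seq ((Steps.push _ _ _).seq
      ((Steps.push _ _ _).seq (Steps.push _ _ _)))))))).mono le_rfl :)

theorem steps_previousBlock (u : ℕ) :
    Steps previousBlock ⟨i, a, ticks (u + 8), t, c, l, o⟩ ⟨i, a, ticks u, t, c, l, o⟩ 8 :=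
  (((Steps.pop _ _).seq ((Steps.pop _ _).seq ((Steps.pop _ _).seq
    ((Steps.pop _ _).seq ((Steps.pop _ _).seq ((Steps.pop _ _).seq
      ((Steps.pop _ _).seq (Steps.pop _ _)))))))).mono le_rfl :)

theorem steps_moveTicks (b : List Symbol) (v : ℕ) (hi : isTick i.head? = false) :
    Steps moveTicks ⟨ticks v ++ i, a, b, t, c, l, o⟩ ⟨i, ticks v ++ a, b, t, c, l, o⟩
      (2 * v + 1) := by
  induction v generalizing a with
  | zero => exact .loop_false hi
  | succ v ih =>
    have h := ih (.tick :: a)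
    rw [ticks_append_cons] at h
    refine Steps.mono (Steps.loop_true rfl (Steps.move _ _ _ .tick (ticks v ++ i) rfl) h) ?_
    omega

theorem steps_clearLast (b : List Symbol) (v : ℕ) :
    Steps clearLast ⟨i, a, b, t, c, ticks v, o⟩ ⟨i, a, b, t, c, [], o⟩ (2 * v + 1) := by
  induction v with
  | zero => exact .loop_false rfl
  | succ v ih =>
    refine Steps.mono (Steps.loop_true rfl (Steps.pop _ _) ih) ?_
    omega

theorem isTick_signSymbol_cons (b : Bool) (i : List Symbol) :
    isTick (signSymbol b :: i).head? = false := by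
  cases b <;> rfl

theorem isMark_signSymbol_cons (b : Bool) (i : List Symbol) :
    isMark (signSymbol b :: i).head? = false := by
  cases b <;> rfl

theorem literalWord_append (v : ℕ) (b : Bool) (i : List Symbol) :
    literalWord (v, b) ++ i = ticks v ++ signSymbol b :: i := by
  simp [literalWord]

theorem literalWord_reverse_append (v : ℕ) (b : Bool) (i : List Symbol) :
    (literalWord (v, b)).reverse ++ i = signSymbol b :: (ticks v ++ i) := by
  simp [literalWord]

theorem steps_gadgetPass {Z n : ℕ} (is : List Item) (u : ℕ) (hu : u + 8 * is.length ≤ Z)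
    (his : ∀ v b, some (v, b) ∈ is → v ≤ Z) :
    Steps gadgetPass ⟨is.flatMap itemWord, a, ticks u, [], c, ticks n, o⟩
      ⟨[], (is.flatMap itemWord).reverse ++ a, ticks (u + 8 * is.length), [], c, ticks n,
        (gadgets u is).flatMap clauseWord ++ o⟩ (is.length * (50 * Z + 200) + 1) := by
  induction is generalizing u a o with
  | nil =>
    have h : Steps gadgetPass ⟨[], a, ticks u, [], c, ticks n, o⟩
      ⟨[], a, ticks u, [], c, ticks n, o⟩ 1 := .loop_false rfl
    simpa [gadgets] using h
  | cons it is ih =>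
    rw [List.length_cons] at hu
    have hrest := ih ((itemWord it).reverse ++ a) ((gadget u it).flatMap clauseWord ++ o) (u + 8)
      (by omega) (fun v b hv => his v b (List.mem_cons_of_mem _ hv))
    rw [List.flatMap_cons, List.reverse_append, gadgets, List.flatMap_append, List.append_assoc,
      List.append_assoc, List.length_cons, show u + 8 * (is.length + 1) = u + 8 + 8 * is.length by
        ring, show (is.length + 1) * (50 * Z + 200) + 1 =
          (50 * Z + 199) + (is.length * (50 * Z + 200) + 1) + 1 by ring]
    rcases it with _ | ⟨v, b⟩
    · refine Steps.loop_true rfl ?_ hrest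
      refine Steps.mono ((steps_moveTicks _ _ _ _ _ _ _ 0 rfl).seq ((Steps.ite_true rfl
        (emits_emitGadgetNone _ _ _ _ _ _)).seq ((Steps.move _ _ _ .mark _ rfl).seq
          (steps_nextBlock _ _ _ _ _ _ _)))) ?_
      omega
    · have hv := his v b (by simp)
      have hm := emits_emitGadgetSome (signSymbol b :: is.flatMap itemWord) (ticks v ++ a) c u n v b
      have hp : Steps (.ite .inp isPos (emitGadgetSome true) (emitGadgetSome false))
          ⟨signSymbol b :: is.flatMap itemWord, ticks v ++ a, ticks u, [], c, ticks n, o⟩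
          ⟨signSymbol b :: is.flatMap itemWord, ticks v ++ a, ticks u, [], c, ticks n,
            (gadget u (some (v, b))).flatMap clauseWord ++ o⟩ (45 * u + 102 + 1) := by
        cases b
        · exact .ite_false rfl (hm o)
        · exact .ite_true rfl (hm o)
      rw [itemWord, literalWord_append, literalWord_reverse_append]
      rw [itemWord, literalWord_reverse_append] at hrest
      refine Steps.loop_true (by rcases v with _ | v <;> rfl) ?_ hrest
      refine Steps.mono ((steps_moveTicks _ _ _ _ _ _ _ v (isTick_signSymbol_cons _ _)).seq
        ((Steps.ite_false (isMark_signSymbol_cons _ _) hp).seq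
          ((Steps.move _ _ _ (signSymbol b) _ rfl).seq (steps_nextBlock _ _ _ _ _ _ _)))) ?_
      omega

/-- The final `n'` is the end of the chain of copies. Only its size matters, for the cost of
clearing it. -/
theorem steps_linkPass {Z : ℕ} (is : List Item) (u n : ℕ) (hu : u + 8 * is.length ≤ Z)
    (hn : n ≤ Z) (his : ∀ v b, some (v, b) ∈ is → v ≤ Z) :
    ∃ n' ≤ Z, Steps linkPass ⟨is.flatMap itemWord, a, ticks u, [], c, ticks n, o⟩
      ⟨[], ((is.map strike).flatMap itemWord).reverse ++ a, ticks (u + 8 * is.length), [], c,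
        ticks n', (links n u is).flatMap clauseWord ++ o⟩
      (is.length * (60 * Z + 200) + 1) := by
  induction is generalizing u n a o with
  | nil =>
    have h : Steps linkPass ⟨[], a, ticks u, [], c, ticks n, o⟩
      ⟨[], a, ticks u, [], c, ticks n, o⟩ 1 := .loop_false rfl
    exact ⟨n, hn, by simpa [links] using h⟩
  | cons it is ih =>
    rw [List.length_cons] at hu
    have his' : ∀ v b, some (v, b) ∈ is → v ≤ Z := fun v b hv =>
      his v b (List.mem_cons_of_mem _ hv)
    rw [List.map_cons, List.flatMap_cons, List.flatMap_cons, List.reverse_append,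
      List.append_assoc, List.length_cons, show u + 8 * (is.length + 1) = u + 8 + 8 * is.length by
        ring, show (is.length + 1) * (60 * Z + 200) + 1 =
          (60 * Z + 199) + (is.length * (60 * Z + 200) + 1) + 1 by ring]
    rcases it with _ | ⟨_ | v, b⟩
    · obtain ⟨n', hn', hrest⟩ := ih ([.mark] ++ a) o (u + 8) n (by omega) hn his'
      refine ⟨n', hn', Steps.loop_true rfl ?_ hrest⟩
      refine Steps.mono ((Steps.ite_false rfl (Steps.ite_true rfl
        (Steps.move _ _ _ .mark _ rfl))).seq (steps_nextBlock _ _ _ _ _ _ _)) ?_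
      omega
    · obtain ⟨n', hn', hrest⟩ := ih ([.mark] ++ a) ((link n u).flatMap clauseWord ++ o) (u + 8)
        (u + 1) (by omega) (by omega) his'
      rw [links, List.flatMap_append, List.append_assoc]
      refine ⟨n', hn', Steps.loop_true (by cases b <;> rfl) ?_ hrest⟩
      have hS : IsStoreOf .base .last
          (fun x y z => ⟨signSymbol b :: is.flatMap itemWord, a, x, z, c, y,
            (link n u).flatMap clauseWord ++ o⟩) := by
        constructor <;> intros <;> rfl
      have hcopy := steps_copyProg hS u []
      rw [List.append_nil] at hcopy
      refine Steps.mono ((Steps.ite_false (isTick_signSymbol_cons _ _) (Steps.ite_false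
        (isMark_signSymbol_cons _ _) ((emits_emitLink _ _ _ u n (show u ≤ Z by omega) hn o).seq
          ((steps_clearLast _ _ _ _ _ _ _).seq (hcopy.seq ((Steps.push _ _ _).seq
            ((Steps.pop _ _).seq (Steps.push _ _ _)))))))).seq (steps_nextBlock _ _ _ _ _ _ _)) ?_
      omega
    · have hv := his (v + 1) b (by simp)
      obtain ⟨n', hn', hrest⟩ := ih ((literalWord (v, b)).reverse ++ a) o (u + 8) n (by omega) hn
        his'
      refine ⟨n', hn', Steps.loop_true rfl ?_ hrest⟩
      rw [literalWord_reverse_append, itemWord, literalWord_append]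
      refine Steps.mono ((Steps.ite_true rfl ((Steps.pop _ _).seq
        ((steps_moveTicks _ _ _ _ _ _ _ v (isTick_signSymbol_cons b (is.flatMap itemWord))).seq
        (Steps.move _ _ _ (signSymbol b) _ rfl)))).seq (steps_nextBlock _ _ _ _ _ _ _)) ?_
      omega

/-- The number of items in a word. -/
def countItems (w : List Symbol) : ℕ := w.countP (· != .tick)

theorem countItems_flatMap_itemWord (is : List Item) :
    countItems (is.flatMap itemWord) = is.length := by
  induction is with
  | nil => rfl
  | cons it is ih =>
    rw [List.flatMap_cons, countItems, List.countP_append, ← countItems, ← countItems, ih,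
      List.length_cons, add_comm]
    rcases it with _ | ⟨v, _ | _⟩
    · rfl
    · simp [countItems, itemWord, literalWord, signSymbol]
    · simp [countItems, itemWord, literalWord, signSymbol]

/-- The word of an item contains exactly one symbol other than a tick, so `base` can be turned back
without parsing, and `w` may be arbitrary. -/
theorem steps_restorePass (w : List Symbol) (u : ℕ) :
    Steps restorePass ⟨i, w, ticks (u + 8 * countItems w), t, c, l, o⟩
      ⟨w.reverse ++ i, [], ticks u, t, c, l, o⟩ (11 * w.length + 1) := by
  induction w generalizing i with
  | nil => exact .loop_false rfl
  | cons s w ih =>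
    have h := ih (s :: i)
    rw [List.reverse_cons, List.append_assoc, List.length_cons, List.singleton_append,
      show 11 * (w.length + 1) + 1 = 10 + (11 * w.length + 1) + 1 by ring]
    by_cases hs : s = .tick
    · subst hs
      exact Steps.loop_true rfl ((Steps.ite_true rfl (Steps.move _ _ _ _ _ rfl)).mono (by omega)) h
    · have hc : countItems (s :: w) = countItems w + 1 := by
        simp [countItems, hs]
      rw [hc, show u + 8 * (countItems w + 1) = u + 8 * countItems w + 8 by ring]
      have hs' : isTick (s :: w).head? = false := by simp [isTick, hs]
      exact Steps.loop_true rfl (Steps.mono (Steps.ite_false hs' ((Steps.move _ _ _ _ _ rfl).seq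
        (steps_previousBlock _ _ _ _ _ _ _))) (show 1 + 8 + 1 ≤ 10 by omega)) h

theorem steps_clearPass (w : List Symbol) (u : ℕ) :
    Steps clearPass ⟨w, a, ticks u, t, c, l, o⟩
      ⟨[], a, ticks (u + 8 * countItems w), t, c, l, o⟩ (11 * w.length + 1) := by
  induction w generalizing u with
  | nil => exact .loop_false rfl
  | cons s w ih =>
    rw [List.length_cons, show 11 * (w.length + 1) + 1 = 10 + (11 * w.length + 1) + 1 by ring]
    by_cases hs : s = .tick
    · subst hs
      exact Steps.loop_true rfl ((Steps.ite_true rfl (Steps.pop _ _)).mono (by omega)) (ih u)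
    · have hc : countItems (s :: w) = countItems w + 1 := by
        simp [countItems, hs]
      rw [hc, show u + 8 * (countItems w + 1) = u + 8 + 8 * countItems w by ring]
      have hs' : isTick (s :: w).head? = false := by simp [isTick, hs]
      exact Steps.loop_true rfl (Steps.mono (Steps.ite_false hs' ((Steps.pop _ _).seq
        (steps_nextBlock _ _ _ _ _ _ _))) (show 1 + 8 + 1 ≤ 10 by omega)) (ih (u + 8))

theorem length_flatMap_itemWord_le {Z : ℕ} {is : List Item}
    (his : ∀ v b, some (v, b) ∈ is → v ≤ Z) :
    (is.flatMap itemWord).length ≤ is.length * (Z + 1) := by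
  induction is with
  | nil => simp
  | cons it is ih =>
    have h := ih fun v b hv => his v b (List.mem_cons_of_mem _ hv)
    rw [List.flatMap_cons, List.length_append, List.length_cons, add_mul, one_mul, add_comm]
    refine add_le_add h ?_
    rcases it with _ | ⟨v, b⟩
    · simp [itemWord]
    · simpa [itemWord, literalWord] using his v b (by simp)

theorem strike_le {Z : ℕ} {is : List Item} (his : ∀ v b, some (v, b) ∈ is → v ≤ Z) :
    ∀ v b, some (v, b) ∈ is.map strike → v ≤ Z := by
  intro v b hv
  obtain ⟨it, hit, h⟩ := List.mem_map.1 hv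
  match it, hit, h with
  | some (w + 1, b'), hit, h =>
    simp only [strike, Option.some.injEq, Prod.mk.injEq] at h
    have := his _ _ hit
    omega

theorem steps_roundProg {Z n k : ℕ} (is : List Item) (hu : n + 8 * is.length ≤ Z) (hk : k ≤ Z)
    (his : ∀ v b, some (v, b) ∈ is → v ≤ Z) :
    Steps roundProg ⟨is.flatMap itemWord, [], ticks n, [], ticks k, [], o⟩
      ⟨(is.map strike).flatMap itemWord, [], ticks n, [], ticks k, [],
        (links k n is).flatMap clauseWord ++ o⟩ ((is.length + 1) * (80 * Z + 300)) := by
  have hS : IsStoreOf .cnt .last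
      (fun x y z => ⟨is.flatMap itemWord, [], ticks n, z, x, y, o⟩) := by
    constructor <;> intros <;> rfl
  have hcopy := steps_copyProg hS k []
  rw [List.append_nil] at hcopy
  obtain ⟨n', hn', hlink⟩ := steps_linkPass [] (ticks k) o is n k hu hk his
  have hclear := steps_clearLast [] (((is.map strike).flatMap itemWord).reverse ++ []) (ticks k)
    ((links k n is).flatMap clauseWord ++ o) [] (ticks (n + 8 * is.length)) n'
  have hrestore := steps_restorePass [] (ticks k) [] ((links k n is).flatMap clauseWord ++ o) []
    ((is.map strike).flatMap itemWord).reverse n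
  have hlen := length_flatMap_itemWord_le (strike_le his)
  rw [List.append_nil] at hlink hclear
  rw [List.reverse_reverse, List.append_nil, List.length_reverse, countItems, List.countP_reverse,
    ← countItems, countItems_flatMap_itemWord, List.length_map] at hrestore
  rw [List.length_map] at hlen
  refine (hcopy.seq (hlink.seq (hclear.seq hrestore))).mono ?_
  nlinarith

/-- The remaining items `is'` are only counted and erased afterwards, so their number and a bound on
their indices suffice. -/
theorem steps_roundsProg {Z n k : ℕ} (is : List Item) (hu : n + 8 * is.length ≤ Z) (hk : k ≤ Z)
    (his : ∀ v b, some (v, b) ∈ is → v ≤ Z) :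
    ∃ is' : List Item, is'.length = is.length ∧ (∀ v b, some (v, b) ∈ is' → v ≤ Z) ∧
      Steps roundsProg ⟨is.flatMap itemWord, [], ticks n, [], ticks k, [], o⟩
        ⟨is'.flatMap itemWord, [], ticks n, [], [], [],
          (rounds n k is).flatMap clauseWord ++ o⟩
        (k * ((is.length + 1) * (80 * Z + 300) + 2) + 1) := by
  induction k generalizing is o with
  | zero => exact ⟨is, rfl, his, (Steps.loop_false rfl).mono (by omega)⟩
  | succ k ih =>
    obtain ⟨is', h1, h2, h3⟩ := ih ((links k n is).flatMap clauseWord ++ o) (is.map strike)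
      (by simpa using hu) (by omega) (strike_le his)
    rw [List.length_map] at h1 h3
    refine ⟨is', h1, h2, ?_⟩
    rw [rounds, List.flatMap_append, List.append_assoc]
    refine (Steps.loop_true rfl ((Steps.pop _ _).seq
      (steps_roundProg o is hu (by omega) his)) h3).mono (le_of_eq ?_)
    ring

theorem steps_parseProg (x y : ℕ) (n : ℕ) (hi : isTick i.head? = false) :
    Steps parseProg ⟨ticks n ++ i, a, ticks x, t, ticks y, l, o⟩
      ⟨i, a, ticks (x + n), t, ticks (y + n), l, o⟩ (3 * n + 1) := by
  induction n generalizing x y with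
  | zero => exact .loop_false hi
  | succ n ih =>
    have h := ih (x + 1) (y + 1)
    rw [add_right_comm, add_right_comm y] at h
    refine Steps.mono (Steps.loop_true rfl ((Steps.push _ _ _).seq
      (Steps.move _ _ _ .tick (ticks n ++ i) rfl)) h) ?_
    omega

theorem steps_emitHeader (u : ℕ) :
    Steps emitHeader ⟨i, a, ticks u, t, c, l, o⟩
      ⟨i, a, [], t, c, l, ticks (u + 1) ++ .mark :: o⟩ (2 * u + 3) := by
  have h : ∀ u o, Steps (.loop .base isTick (.move .base .out)) ⟨i, a, ticks u, t, c, l, o⟩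
      ⟨i, a, [], t, c, l, ticks u ++ o⟩ (2 * u + 1) := by
    intro u
    induction u with
    | zero => exact fun o => .loop_false rfl
    | succ u ih =>
      intro o
      have h := ih (.tick :: o)
      rw [ticks_append_cons] at h
      refine Steps.mono (Steps.loop_true rfl (Steps.move _ _ _ .tick (ticks u) rfl) h) ?_
      omega
  have h' := h u (.tick :: .mark :: o)
  rw [ticks_append_cons] at h'
  exact ((Steps.push _ _ _).seq ((Steps.push _ _ _).seq h')).mono (by omega)

theorem steps_moveOut (b : List Symbol) :
    Steps (.loop .out Option.isSome (.move .out .aux)) ⟨i, a, b, t, c, l, o⟩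
      ⟨i, o.reverse ++ a, b, t, c, l, []⟩ (2 * o.length + 1) := by
  induction o generalizing a with
  | nil => exact .loop_false rfl
  | cons s o ih =>
    have h := ih (s :: a)
    rw [List.reverse_cons, List.append_assoc, List.length_cons]
    refine Steps.mono (Steps.loop_true rfl (Steps.move _ _ _ s o rfl) h) ?_
    omega

end Passes

/-! ### The total running time of the reduction -/

theorem Formula.le_of_mem_items {φ : Formula} {v : ℕ} {b : Bool} (h : some (v, b) ∈ φ.items) :
    v ≤ φ.numVars := by
  obtain ⟨p, hp⟩ := List.mem_iff_getElem?.1 h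
  refine (lt_of_formulaItems (n := φ.numVars) ?_ hp).le
  simp only [Formula.natClauses, List.forall_mem_map]
  exact fun c _ l _ => l.1.isLt

theorem steps_reduceToOut (φ : Formula) :
    Steps reduceToOut ⟨encodeFormula φ, [], [], [], [], [], []⟩
      ⟨[], [], [], [], [], [], encodeFormula φ.reduce⟩ (1000 * (φ.reduce.numVars + 1) ^ 3) := by
  set is := φ.items with his_def
  set n := φ.numVars with hn
  set Z := n + 8 * is.length with hZ
  have his : ∀ v b, some (v, b) ∈ is → v ≤ Z := fun v b hv =>
    (Formula.le_of_mem_items hv).trans (Nat.le_add_right _ _)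
  -- The side condition holds because the first item is the leading end, whose word is a mark.
  have h1 := steps_parseProg (is.flatMap itemWord) [] [] [] [] 0 0 n rfl
  rw [zero_add, hn, his_def, ← encodeFormula_eq_items] at h1
  have h2 := steps_gadgetPass [] (ticks n) [] (n := 0) is n hZ.ge his
  have h3 := steps_restorePass [] (ticks n) [] ((gadgets n is).flatMap clauseWord ++ []) []
    (is.flatMap itemWord).reverse n
  have hlen := length_flatMap_itemWord_le his
  rw [List.reverse_reverse, List.append_nil, List.length_reverse, countItems, List.countP_reverse,
    ← countItems, countItems_flatMap_itemWord] at h3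
  rw [List.append_nil, List.append_nil] at h2
  rw [List.append_nil] at h3
  obtain ⟨is', h4, h5, h6⟩ := steps_roundsProg ((gadgets n is).flatMap clauseWord) (k := n) is
    hZ.ge (by omega) his
  rw [← List.flatMap_append, ← reductionClauses] at h6
  have h7 := steps_clearPass [] [] [] ((reductionClauses n is).flatMap clauseWord) []
    (is'.flatMap itemWord) n
  have hlen' := length_flatMap_itemWord_le h5
  rw [countItems_flatMap_itemWord] at h7
  rw [h4] at h7 hlen'
  have h8 := steps_emitHeader [] [] [] [] ((reductionClauses n is).flatMap clauseWord) []
    (n + 8 * is.length)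
  rw [encodeFormula_eq φ.reduce, φ.natClauses_reduce]
  refine (h1.seq (h2.seq (h3.seq (h6.seq (h7.seq h8))))).mono ?_
  change _ ≤ 1000 * (n + 8 * is.length + 1 + 1) ^ 3
  rw [← hZ]
  -- All products are bounded by powers of `Z + 2`, which is the new number of variables plus one;
  -- the rest is then linear in these powers.
  have hP : is.length ≤ Z + 2 := by omega
  have e1 : is.length * (50 * Z + 200) ≤ (Z + 2) * (100 * (Z + 2)) :=
    Nat.mul_le_mul hP (by omega)
  have e2 : is.length * (Z + 1) ≤ (Z + 2) * (Z + 2) := Nat.mul_le_mul hP (by omega)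
  have e3 : n * ((is.length + 1) * (80 * Z + 300) + 2) ≤
      (Z + 2) * ((Z + 2) * (150 * (Z + 2)) + 2) :=
    Nat.mul_le_mul (by omega) (Nat.add_le_add_right (Nat.mul_le_mul (by omega) (by omega)) 2)
  have e4 : (Z + 1 + 1) ^ 3 = (Z + 2) * ((Z + 2) * (Z + 2)) := by ring
  have e5 : 2 * ((Z + 2) * (Z + 2)) ≤ (Z + 2) * ((Z + 2) * (Z + 2)) :=
    Nat.mul_le_mul_right _ (by omega)
  have e6 : 2 * (Z + 2) ≤ (Z + 2) * (Z + 2) := Nat.mul_le_mul_right _ (by omega)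
  have e7 : (Z + 2) * (100 * (Z + 2)) = 100 * ((Z + 2) * (Z + 2)) := by ring
  have e8 : (Z + 2) * ((Z + 2) * (150 * (Z + 2)) + 2) =
    150 * ((Z + 2) * ((Z + 2) * (Z + 2))) + 2 * (Z + 2) := by ring
  rw [e4]
  omega

theorem exists_runs_reduceProg (φ : Formula) :
    ∃ t ≤ 4000 * (φ.reduce.numVars + 1) ^ 3,
      (encodeFormula φ.reduce).length ≤ 1000 * (φ.reduce.numVars + 1) ^ 3 ∧
        Runs reduceProg ⟨encodeFormula φ, [], [], [], [], [], []⟩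
          ⟨[], (encodeFormula φ.reduce).reverse, [], [], [], [], []⟩ t := by
  obtain ⟨t, ht, hr⟩ := steps_reduceToOut φ
  have hlen : (encodeFormula φ.reduce).length ≤ 0 + t := hr.length_get_le .out
  obtain ⟨t', ht', hr'⟩ := steps_moveOut [] [] [] [] (encodeFormula φ.reduce) [] []
  rw [List.append_nil] at hr'
  have hpos : 0 < (φ.reduce.numVars + 1) ^ 3 := by positivity
  exact ⟨t' + t, by omega, by omega, hr.seq hr'⟩

/-! ### Asymptotic estimates and the conclusion -/

open Filter Asymptotics

/-- The function `f` need not be monotone and the new size is only known up to a linear bound, so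
`f` is replaced by its maximum over all possible sizes. Sizes up to `N₀` contribute a constant;
larger ones are controlled by the choice of `N₀`. -/
theorem isLittleO_sup'_range {f : ℕ → ℝ} (hf : f =o[atTop] fun n : ℕ => (n : ℝ)) (a b : ℕ) :
    (fun s : ℕ => (Finset.range (a * s + b + 1)).sup' ⟨0, by simp⟩ fun N => |f N|)
      =o[atTop] fun n : ℕ => (n : ℝ) := by
  rw [isLittleO_iff]
  intro ε hε
  have hε' : 0 < ε / (a + b + 1) := by positivity
  obtain ⟨N₀, hN₀⟩ := eventually_atTop.1 (isLittleO_iff.1 hf hε')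
  set C := (Finset.range (N₀ + 1)).sup' ⟨0, by simp⟩ fun N => |f N| with hC
  filter_upwards [eventually_ge_atTop 1, eventually_ge_atTop ⌈C / ε⌉₊] with s hs hsC
  have hs' : (1 : ℝ) ≤ s := by exact_mod_cast hs
  have hCs : C ≤ ε * s := by
    rw [mul_comm, ← div_le_iff₀ hε]
    exact Nat.ceil_le.1 hsC
  rw [Real.norm_of_nonneg (by positivity : (0 : ℝ) ≤ s), Real.norm_eq_abs, abs_of_nonneg
    (le_trans (abs_nonneg (f 0)) (Finset.le_sup' (fun N => |f N|) (by simp)))]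
  refine Finset.sup'_le _ _ fun N hN => ?_
  rcases le_total N N₀ with h | h
  · exact (Finset.le_sup' (fun N => |f N|) (by simpa [Nat.lt_succ_iff] using h)).trans hCs
  · have h1 := hN₀ N h
    rw [Real.norm_eq_abs, Real.norm_of_nonneg (by positivity : (0 : ℝ) ≤ N)] at h1
    have h2 : (N : ℝ) ≤ (a + b + 1) * s := by
      have : N ≤ a * s + b := by simpa [Nat.lt_succ_iff] using hN
      have h3 : (N : ℝ) ≤ a * s + b := by exact_mod_cast this
      have h4 : (b : ℝ) * 1 ≤ b * s := by gcongr
      nlinarith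
    calc |f N| ≤ ε / (a + b + 1) * N := h1
      _ ≤ ε / (a + b + 1) * ((a + b + 1) * s) := by gcongr
      _ = ε * s := by field_simp

theorem isLittleO_logb_cubic (C : ℝ) (hC : 0 < C) (a b : ℕ) (hb : 0 < b) :
    (fun s : ℕ => Real.logb 2 (C * (a * s + b) ^ 3)) =o[atTop] fun n : ℕ => (n : ℝ) := by
  have h1 : (fun s : ℕ => Real.logb 2 (C * (a * s + b) ^ 3)) = fun s : ℕ =>
      (Real.log 2)⁻¹ * (Real.log C + 3 * Real.log (a * s + b)) := by
    funext s
    have hpos : (0 : ℝ) < a * s + b := by positivity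
    rw [Real.logb, Real.log_mul hC.ne' (by positivity), Real.log_pow]
    push_cast
    ring
  rw [h1]
  have hconst : ∀ D : ℝ, (fun _ : ℕ => D) =o[atTop] fun n : ℕ => (n : ℝ) := fun D =>
    isLittleO_const_left.2 (.inr (by
      simpa [Function.comp_def] using tendsto_natCast_atTop_atTop (R := ℝ)))
  refine IsLittleO.const_mul_left (IsLittleO.add (hconst _) (IsLittleO.const_mul_left ?_ _)) _
  rcases Nat.eq_zero_or_pos a with rfl | ha
  · simpa using hconst (Real.log b)
  · have ht : Tendsto (fun s : ℕ => (a * s + b : ℝ)) atTop atTop :=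
      tendsto_atTop_add_const_right _ _
        (tendsto_natCast_atTop_atTop.const_mul_atTop (by exact_mod_cast ha))
    refine (Real.isLittleO_log_id_atTop.comp_tendsto ht).trans_isBigO ?_
    exact IsBigO.add (IsBigO.const_mul_left (isBigO_refl _ _) _) (hconst _).isBigO

open Classical in
/-- A subexponential algorithm for (3,4)-XSAT gives one for 3-SAT, since `Formula.reduce` increases
the size only linearly and is computed in polynomial time. -/
theorem decidableInSubexpTime_threeSat
    (h : DecidableInSubexpTime Formula.IsThreeFour Formula.ExactlyOneSatisfiable
      Formula.numVars) :
    DecidableInSubexpTime Formula.IsThreeCNF Formula.Satisfiable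
      (fun φ => φ.numVars + φ.numClauses) := by
  obtain ⟨f, hf, M, hM⟩ := h
  -- There are at most `n + 8 * (4 * m + 1) + 1 ≤ 32 * s + 9` new variables. The polynomial overhead
  -- enters the exponent as a logarithm; 6000 covers the time of the reduction (4000), the transfer
  -- of its output (1000) and the additive constants.
  refine ⟨_, (isLittleO_sup'_range hf 32 9).add (isLittleO_logb_cubic 6000 (by norm_num) 32 10
    (by norm_num)), precompose reduceProg M, fun φ hφ => ?_⟩
  obtain ⟨t', ht', hout⟩ := hM φ.reduce φ.isThreeFour_reduce
  obtain ⟨t, ht, hlen, hruns⟩ := exists_runs_reduceProg φ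
  set s := φ.numVars + φ.numClauses with hs
  have hN : φ.reduce.numVars ≤ 32 * s + 9 := by
    have h1 : φ.reduce.numVars = φ.numVars + 8 * φ.items.length + 1 := rfl
    have h2 := Formula.length_items_le hφ
    omega
  refine ⟨t' + ((encodeFormula φ.reduce).length + 1 + t), ?_, ?_⟩
  swap
  · have := precompose_outputsInTime reduceProg M hruns hout
    rwa [show decide φ.reduce.ExactlyOneSatisfiable = decide φ.Satisfiable from
      decide_eq_decide.2 φ.exactlyOneSatisfiable_reduce] at this
  · set F := (Finset.range (32 * s + 9 + 1)).sup' ⟨0, by simp⟩ fun N => |f N| with hF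
    have hF0 : 0 ≤ F := le_trans (abs_nonneg (f 0)) (Finset.le_sup' (fun N => |f N|) (by simp))
    have hfF : f φ.reduce.numVars ≤ F := (le_abs_self _).trans
      (Finset.le_sup' (fun N => |f N|) (by simpa [Nat.lt_succ_iff] using hN))
    have h1 : (t' : ℝ) ≤ 2 ^ F :=
      ht'.trans (Real.rpow_le_rpow_of_exponent_le (by norm_num) hfF)
    have h2 : (1 : ℝ) ≤ 2 ^ F := Real.one_le_rpow (by norm_num) hF0
    have h3 : (encodeFormula φ.reduce).length + 1 + t + 1 ≤ 6000 * (32 * s + 10) ^ 3 := by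
      have h4 : (φ.reduce.numVars + 1) ^ 3 ≤ (32 * s + 10) ^ 3 :=
        Nat.pow_le_pow_left (by omega) 3
      have h5 : 0 < (32 * s + 10) ^ 3 := by positivity
      omega
    have h3' : ((encodeFormula φ.reduce).length + 1 + t : ℝ) + 1 ≤
        6000 * (32 * s + 10) ^ 3 := by exact_mod_cast h3
    have h0 : (0 : ℝ) ≤ (encodeFormula φ.reduce).length + 1 + t := by positivity
    change _ ≤ (2 : ℝ) ^ (F + Real.logb 2 (6000 * (((32 : ℕ) : ℝ) * s + ((10 : ℕ) : ℝ)) ^ 3))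
    rw [Real.rpow_add (by norm_num), Real.rpow_logb (by norm_num) (by norm_num) (by positivity)]
    push_cast
    -- As `1 ≤ 2 ^ F`, the sum of the two running times is at most `2 ^ F` times the overhead plus
    -- one.
    calc (t' : ℝ) + ((encodeFormula φ.reduce).length + 1 + t)
        ≤ 2 ^ F * ((encodeFormula φ.reduce).length + 1 + t + 1) := by nlinarith
      _ ≤ 2 ^ F * (6000 * (32 * s + 10) ^ 3) := by gcongr

end SatHardness

/-- Unless the ETH fails, (3,4)-XSAT cannot be decided in time `2 ^ o(n)`, where `n` is the number of
variables of the input formula. -/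
theorem mainTheorem10 (hETH : SatHardness.ETH) :
    ¬ SatHardness.DecidableInSubexpTime SatHardness.Formula.IsThreeFour
        SatHardness.Formula.ExactlyOneSatisfiable SatHardness.Formula.numVars :=
  fun h => hETH (SatHardness.decidableInSubexpTime_threeSat h)
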